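/- Let $n\in\mathbb N$, let $\mathbb B^n$ be the open unit ball of $\mathbb C^n$ with the Euclidean norm, and let $\mathrm{Hol}(\mathbb B^n,\mathbb C^n)$ be the set of holomorphic maps $\mathbb B^n\to\mathbb C^n$ with the topology of locally uniform convergence. Let $\mathbb U_n$ be the set of all $h\in\mathrm{Hol}(\mathbb B^n,\mathbb C^n)$ with $h(0)=0$, $Dh(0)=-\mathrm{id}$ and $\operatorname{Re}\langle h(z),z\rangle\le 0$ for all $z\in\mathbb B^n$. A Herglotz vector field in the class $\mathbb U_n$ is a mapping $G:\mathbb B^n\times[0,\infty)\to\mathbb C^n$ such that $G(z,\cdot)$ is measurable for every $z\in\mathbb B^n$ and $G(\cdot,t)\in\mathbb U_n$ for a.e. $t\ge 0$. The Loewner equation for $G$ is $$\frac{\partial\varphi}{\partial t}(t,z)=G(\varphi(t,z),t)\ \text{ for a.e. } t\ge 0,\qquad \varphi(0,z)=z\qquad(z\in\mathbb B^n),$$ where a solution is a map $\varphi:[0,\infty)\times\mathbb B^n\to\mathbb B^n$ such that $\varphi(\cdot,z)$ is locally absolutely continuous for each $z$. Let $S_n^0$ be the set of all $f\in\mathrm{Hol}(\mathbb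 B^n,\mathbb C^n)$ of the form $f=\lim_{t\to\infty}e^t\varphi(t,\cdot)$, locally uniformly on $\mathbb B^n$, with $\varphi$ a solution of the Loewner equation for some Herglotz vector field $G$ in the class $\mathbb U_n$. An admissible control is a map $u=u_G:t\mapsto G(\cdot,t)$ with $G$ a Herglotz vector field in the class $\mathbb U_n$; its trajectory is $x_u:t\mapsto\varphi_t=\varphi(t,\cdot)$, where $\varphi$ is the solution of the Loewner equation for $G$. Let $\mathcal U_n$ be the set of admissible controls, and put $\mathcal R(t)=\{e^tx_u(t):u\in\mathcal U_n\}$ for $t\in[0,\infty)$, $\mathcal R(\infty)=\{\lim_{t\to\infty}e^tx_u(t):u\in\mathcal U_n\}$ (locally uniform limits on $\mathbb B^n$), and $\mathcal R=\bigcup_{t\in[0,\infty]}\mathcal R(t)$. Then $$S_n^0=\mathcal R=\mathcal R(\infty).$$ Moreover, for every $u\in\mathcal U_n$ the trajectory $x_u$ exists and is unique, $e^tx_u(t)\in S_n^0$ for every $t\ge 0$, and the limit $\lim_{t\to\infty}e^tx_u(t)$ exists locally uniformly on $\mathbb B^n$ and belongs to $S_n^0$. -/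

import Mathlib

open MeasureTheory Filter Set Topology

noncomputable section

namespace Loewner

/-- The space `ℂⁿ` with its Euclidean norm and inner product. -/
abbrev Cn (n : ℕ) : Type := EuclideanSpace ℂ (Fin n)

/-- The open Euclidean unit ball of `ℂⁿ`. -/
def unitBall (n : ℕ) : Set (Cn n) := Metric.ball 0 1

/-- The holomorphic maps from the unit ball into `ℂⁿ`. A map on the ball is represented by any of
its extensions to a total function `ℂⁿ → ℂⁿ`; the values outside the ball play no role, here and in
all the definitions below. -/
def Hol (n : ℕ) : Set (Cn n → Cn n) := {f | DifferentiableOn ℂ f (unitBall n)}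

/-- The class of holomorphic `h` on the ball with `h(0) = 0`, `Dh(0) = -id` and
`Re ⟨h(z), z⟩ ≤ 0` for all `z` in the ball. -/
def controlSet (n : ℕ) : Set (Cn n → Cn n) :=
  {h | h ∈ Hol n ∧ h 0 = 0 ∧ HasFDerivAt h (-ContinuousLinearMap.id ℂ (Cn n)) 0 ∧
    ∀ z ∈ unitBall n, (inner ℂ (h z) z).re ≤ 0}

/-- Herglotz vector fields `G(z, t)`, `z` in the ball, `t ≥ 0`. Measurability in `t` is Lebesgue
measurability on `[0, ∞)`. -/
structure IsHerglotzField (n : ℕ) (G : Cn n → ℝ → Cn n) : Prop where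
  measurable : ∀ z ∈ unitBall n, AEMeasurable (G z) (volume.restrict (Ici 0))
  mem_controlSet : ∀ᵐ t ∂(volume.restrict (Ici (0 : ℝ))), (fun z => G z t) ∈ controlSet n

/-- `φ t z`, `t ≥ 0`, `z` in the ball, solves the Loewner equation
`∂φ/∂t (t, z) = G (φ (t, z), t)` for a.e. `t ≥ 0`, `φ (0, z) = z`, in the sense of
Carathéodory: for each `z` in the ball, `φ (·, z)` stays in the ball, is absolutely continuous on
compact time intervals and satisfies the equation almost everywhere. -/
structure IsLoewnerSolution (n : ℕ) (G : Cn n → ℝ → Cn n) (φ : ℝ → Cn n → Cn n) : Prop where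
  mem_ball : ∀ z ∈ unitBall n, ∀ t : ℝ, 0 ≤ t → φ t z ∈ unitBall n
  absolutelyContinuous : ∀ z ∈ unitBall n, ∀ T : ℝ, 0 ≤ T →
    AbsolutelyContinuousOnInterval (fun t => φ t z) 0 T
  equation : ∀ z ∈ unitBall n, ∀ᵐ t ∂(volume.restrict (Ici (0 : ℝ))),
    HasDerivAt (fun s => φ s z) (G (φ t z) t) t
  initial : ∀ z ∈ unitBall n, φ 0 z = z

/-- `e^t φ_t → f` as `t → ∞`, locally uniformly on the ball. -/
def IsLoewnerLimit (n : ℕ) (φ : ℝ → Cn n → Cn n) (f : Cn n → Cn n) : Prop :=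
  TendstoLocallyUniformlyOn (fun (t : ℝ) z => Real.exp t • φ t z) f atTop (unitBall n)

/-- The class `S⁰ₙ` of maps with parametric representation: the holomorphic maps on the ball of the
form `f = lim_{t → ∞} e^t φ(t, ·)`, with `φ` the solution of the Loewner equation for a
Herglotz vector field `G`. -/
def S0 (n : ℕ) : Set (Cn n → Cn n) :=
  {f | f ∈ Hol n ∧ ∃ G φ, IsHerglotzField n G ∧ IsLoewnerSolution n G φ ∧ IsLoewnerLimit n φ f}

/-- The control `t ↦ G(·, t)` of a vector field `G`. -/
def controlOf {n : ℕ} (G : Cn n → ℝ → Cn n) : ℝ → Cn n → Cn n := fun t z => G z t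

/-- The admissible controls. -/
def admissibleControls (n : ℕ) : Set (ℝ → Cn n → Cn n) :=
  {u | ∃ G, IsHerglotzField n G ∧ u = controlOf G}

/-- `x` is a trajectory for the control `u`: the curve `t ↦ φ_t` with `φ` a solution of the Loewner
equation for the vector field `G` with `u = controlOf G`. -/
def IsTrajectory (n : ℕ) (u x : ℝ → Cn n → Cn n) : Prop :=
  ∃ G, u = controlOf G ∧ IsLoewnerSolution n G x

/-- The reachable set at the finite time `t`: the maps `e^t x_u(t)` on the ball. -/
def reachableSetAt (n : ℕ) (t : ℝ) : Set (Cn n → Cn n) :=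
  {f | ∃ u ∈ admissibleControls n, ∃ x, IsTrajectory n u x ∧
    EqOn f (fun z => Real.exp t • x t z) (unitBall n)}

/-- The reachable set at time infinity: the maps `lim_{t → ∞} e^t x_u(t)`. -/
def reachableSetInfty (n : ℕ) : Set (Cn n → Cn n) :=
  {f | ∃ u ∈ admissibleControls n, ∃ x, IsTrajectory n u x ∧ IsLoewnerLimit n x f}

/-- The overall reachable set, the union of the reachable sets at all times in `[0, ∞]`. -/
def overallReachableSet (n : ℕ) : Set (Cn n → Cn n) :=
  (⋃ t ∈ Ici (0 : ℝ), reachableSetAt n t) ∪ reachableSetInfty n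

end Loewner

end

/-!
The sets agree because the two kinds of reachable maps are limits at infinity. A reachable map
`e^T φ_T` at a finite time is also the limit belonging to the field that is stopped at time `T`,
that is, replaced by `-id` for `t > T`: from then on `e^t φ_t` is constant
(`IsLoewnerSolution.exp_smul_mem_S0`). What remains is to show that for each Herglotz vector field
the Loewner equation has exactly one solution, that the maps `φ_t` are holomorphic, and that
`e^t φ_t` converges locally uniformly to a holomorphic map.

All of this rests on the compactness of the class `controlSet`. On complex lines through the origin
`-⟨h(ζ e), e⟩ / ζ` is a Carathéodory function, which gives two-sided bounds for `⟨h(z), z⟩`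
(`inner_bounds_of_mem_controlSet`); the maximum principle turns them into a bound for `h`, and the
Schwarz lemma into Lipschitz and second order Taylor estimates, uniform over the class
(`exists_uniform_bounds_controlSet`).

Existence for fields that are only measurable in time is a contraction argument
(`exists_caratheodory_solution`), applied to the field composed with a radial retraction, which does
not matter since `Re⟨h(z), z⟩ ≤ 0` keeps trajectories in their ball. Uniqueness is the Gronwall
estimate. The same estimate, applied to linear combinations of increments of `φ_T`, shows that
`φ_T` is complex linear up to quadratic errors at each point, hence holomorphic
(`differentiableAt_of_quasilinear`, `IsLoewnerSolution.mem_Hol`). The sharp decay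
`|φ_t(z)| ≤ C(r) e^{-t}` for `|z| ≤ r` (`IsLoewnerSolution.norm_le_exp`) together with
`|h(z) + z| ≤ L |z|²` makes the derivative of `e^t φ_t` of order `e^{-t}`, which gives convergence.
-/

open MeasureTheory Filter Set Topology

noncomputable section

namespace Loewner

/-! ### Consequences of the Schwarz lemma for bounded holomorphic maps -/

section Schwarz

variable {E F : Type*} [NormedAddCommGroup E] [NormedSpace ℂ E] [NormedAddCommGroup F]
  [NormedSpace ℂ F] {f : E → F} {c z : E} {R M : ℝ}

theorem norm_sub_le_of_norm_le_on_ball (hf : DifferentiableOn ℂ f (Metric.ball c R))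
    (hM : ∀ w ∈ Metric.ball c R, ‖f w‖ ≤ M) (hz : z ∈ Metric.ball c R) :
    ‖f z - f c‖ ≤ 2 * M / R * ‖z - c‖ := by
  have hR : 0 < R := Metric.nonempty_ball.1 ⟨z, hz⟩
  have hc : c ∈ Metric.ball c R := Metric.mem_ball_self hR
  have := Complex.dist_le_div_mul_dist_of_mapsTo_ball (R₂ := 2 * M) hf (fun w hw => by
    rw [mem_closedBall_iff_norm]
    linarith [norm_sub_le (f w) (f c), hM w hw, hM c hc]) hz
  rwa [dist_eq_norm, dist_eq_norm] at this

theorem norm_fderiv_le_of_norm_le_on_ball (hR : 0 < R)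
    (hf : DifferentiableOn ℂ f (Metric.ball c R)) (hM : ∀ w ∈ Metric.ball c R, ‖f w‖ ≤ M) :
    ‖fderiv ℂ f c‖ ≤ 2 * M / R := by
  have hc : c ∈ Metric.ball c R := Metric.mem_ball_self hR
  refine Complex.norm_fderiv_le_div_of_mapsTo_ball (R₂ := 2 * M) hf (fun w hw => ?_) hR
  rw [mem_closedBall_iff_norm]
  linarith [norm_sub_le (f w) (f c), hM w hw, hM c hc]

/-- The Schwarz lemma of order two, applied to the map minus its affine part. -/
theorem norm_taylor_le_of_norm_le_on_ball (hf : DifferentiableOn ℂ f (Metric.ball c R))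
    (hM : ∀ w ∈ Metric.ball c R, ‖f w‖ ≤ M) (hz : z ∈ Metric.ball c R) :
    ‖f z - f c - fderiv ℂ f c (z - c)‖ ≤ 4 * M / R ^ 2 * ‖z - c‖ ^ 2 := by
  have hR : 0 < R := Metric.nonempty_ball.1 ⟨z, hz⟩
  have hc : c ∈ Metric.ball c R := Metric.mem_ball_self hR
  have hD : HasFDerivAt f (fderiv ℂ f c) c :=
    (hf.differentiableAt (Metric.ball_mem_nhds c hR)).hasFDerivAt
  have key := Complex.dist_le_mul_div_pow_of_mapsTo_ball_of_isLittleO (n := 1) (R₂ := 4 * M)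
    (f := fun w => f w - fderiv ℂ f c (w - c)) (c := c) (R₁ := R) (z := z)
    (hf.sub (((fderiv ℂ f c).differentiable.comp
      (differentiable_id.sub_const c)).differentiableOn)) (fun w hw => ?_) ?_ hz
  · simp only [sub_self, map_zero, sub_zero, dist_eq_norm] at key
    rw [sub_right_comm] at key
    exact key.trans_eq (by ring)
  · rw [mem_closedBall_iff_norm]
    have h1 := norm_fderiv_le_of_norm_le_on_ball hR hf hM
    have h2 : ‖fderiv ℂ f c (w - c)‖ ≤ 2 * M := by
      have hwR : ‖w - c‖ ≤ R := by rw [← dist_eq_norm]; exact (Metric.mem_ball.1 hw).le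
      calc ‖fderiv ℂ f c (w - c)‖ ≤ ‖fderiv ℂ f c‖ * ‖w - c‖ := ContinuousLinearMap.le_opNorm _ _
        _ ≤ 2 * M / R * R := by gcongr; exact (norm_nonneg _).trans h1
        _ = 2 * M := by field_simp
    simp only [sub_self, map_zero, sub_zero]
    rw [sub_right_comm]
    linarith [norm_sub_le (f w - f c) (fderiv ℂ f c (w - c)), norm_sub_le (f w) (f c),
      hM w hw, hM c hc]
  · have := hD.isLittleO
    simp only [sub_self, map_zero, sub_zero, pow_one]
    refine (this.congr_left fun w => by abel).norm_right

end Schwarz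

/-! ### Carathéodory functions and the class of infinitesimal generators -/

/-- The growth bounds for the Carathéodory class of functions with `p 0 = 1`, `0 ≤ Re p`, from
the Schwarz lemma for `(p - 1) / (p + 1)`. -/
theorem caratheodory_bounds {p : ℂ → ℂ} (hp : DifferentiableOn ℂ p (Metric.ball 0 1))
    (h0 : p 0 = 1) (hre : ∀ ζ ∈ Metric.ball (0 : ℂ) 1, 0 ≤ (p ζ).re) {ζ : ℂ} (hζ : ‖ζ‖ < 1) :
    ‖p ζ‖ ≤ (1 + ‖ζ‖) / (1 - ‖ζ‖) ∧ (1 - ‖ζ‖) / (1 + ‖ζ‖) ≤ (p ζ).re := by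
  have hne : ∀ w ∈ Metric.ball (0 : ℂ) 1, p w + 1 ≠ 0 := fun w hw h => by
    have := congrArg Complex.re h
    simp at this
    linarith [hre w hw]
  have hmem : ζ ∈ Metric.ball (0 : ℂ) 1 := by simpa using hζ
  have key : ‖(p ζ - 1) / (p ζ + 1)‖ ≤ ‖ζ‖ := by
    refine Complex.norm_le_norm_of_mapsTo_ball (R := 1) (f := fun w => (p w - 1) / (p w + 1))
      ((hp.sub_const 1).div (hp.add_const 1) hne) (fun w hw => ?_) (by simp [h0]) hζ
    rw [mem_closedBall_zero_iff, norm_div, div_le_one (norm_pos_iff.2 (hne w hw)),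
      ← sq_le_sq₀ (norm_nonneg _) (norm_nonneg _), Complex.sq_norm, Complex.sq_norm,
      Complex.normSq_apply, Complex.normSq_apply]
    simp
    nlinarith [hre w hw]
  rw [norm_div, div_le_iff₀ (norm_pos_iff.2 (hne ζ hmem))] at key
  have hz0 := norm_nonneg ζ
  constructor
  · rw [le_div_iff₀ (by linarith)]
    have h1 : ‖p ζ‖ - 1 ≤ ‖p ζ - 1‖ := by simpa using norm_sub_norm_le (p ζ) 1
    have h2 : ‖p ζ + 1‖ ≤ ‖p ζ‖ + 1 := by simpa using norm_add_le (p ζ) 1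
    nlinarith [mul_le_mul_of_nonneg_left h2 hz0]
  · rw [div_le_iff₀ (by linarith)]
    by_contra! hlt
    have ha := hre ζ hmem
    have hsq := pow_le_pow_left₀ (norm_nonneg _) key 2
    rw [mul_pow, Complex.sq_norm (p ζ - 1), Complex.sq_norm (p ζ + 1), Complex.normSq_apply,
      Complex.normSq_apply] at hsq
    simp at hsq
    have h3 : ‖ζ‖ * ((p ζ).re + 1) < 1 - (p ζ).re := by linarith
    have h4 : (‖ζ‖ * ((p ζ).re + 1)) ^ 2 < (1 - (p ζ).re) ^ 2 :=
      pow_lt_pow_left₀ h3 (by positivity) two_ne_zero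
    have h5 : ‖ζ‖ ^ 2 ≤ 1 := pow_le_one₀ hz0 hζ.le
    nlinarith [mul_nonneg (sub_nonneg.2 h5) (mul_self_nonneg (p ζ).im)]

section Control

variable {n : ℕ} {h : Cn n → Cn n} {z : Cn n}

theorem mem_unitBall : z ∈ unitBall n ↔ ‖z‖ < 1 := mem_ball_zero_iff

/-- On each complex line through the origin spanned by a unit vector `e`, the function
`-⟨h(ζ e), e⟩ / ζ` belongs to the Carathéodory class, which bounds `⟨h(z), z⟩`. -/
theorem inner_bounds_of_mem_controlSet (hh : h ∈ controlSet n) (hz : z ∈ unitBall n) :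
    ‖inner ℂ z (h z)‖ ≤ ‖z‖ ^ 2 * ((1 + ‖z‖) / (1 - ‖z‖)) ∧
      (inner ℂ z (h z)).re ≤ -(‖z‖ ^ 2 * ((1 - ‖z‖) / (1 + ‖z‖))) := by
  obtain ⟨hd, h0, hD, hre⟩ := hh
  rcases eq_or_ne z 0 with rfl | hz0
  · simp
  have hnz : (‖z‖ : ℂ) ≠ 0 := by exact_mod_cast norm_ne_zero_iff.2 hz0
  set e : Cn n := (‖z‖ : ℂ)⁻¹ • z with he
  have hne : ‖e‖ = 1 := by
    rw [he, norm_smul, norm_inv, Complex.norm_real, norm_norm,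
      inv_mul_cancel₀ (norm_ne_zero_iff.2 hz0)]
  have hze : (‖z‖ : ℂ) • e = z := by rw [he, smul_smul, mul_inv_cancel₀ hnz, one_smul]
  have hmaps : ∀ ζ ∈ Metric.ball (0 : ℂ) 1, ζ • e ∈ unitBall n := fun ζ hζ => by
    rw [mem_unitBall, norm_smul, hne, mul_one]; simpa using hζ
  set g : ℂ → ℂ := fun ζ => inner ℂ e (h (ζ • e)) with hg
  have hgd : DifferentiableOn ℂ g (Metric.ball 0 1) :=
    (innerSL ℂ e).differentiable.comp_differentiableOn
      (hd.comp (by fun_prop) hmaps)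
  have hg0 : g 0 = 0 := by simp [hg, h0]
  have hg' : deriv g 0 = -1 := by
    have h1 : HasDerivAt (fun ζ : ℂ => ζ • e) e 0 := by
      simpa using (hasDerivAt_id (0 : ℂ)).smul_const e
    have h2 : HasDerivAt (fun ζ : ℂ => h (ζ • e)) (-e) 0 := by
      have := HasFDerivAt.comp_hasDerivAt (x := (0 : ℂ)) (l := h)
        (l' := -ContinuousLinearMap.id ℂ (Cn n)) (f := fun ζ : ℂ => ζ • e)
        (by simpa using hD) h1
      simpa [Function.comp_def] using this
    have h3 : HasDerivAt g (innerSL ℂ e (-e)) 0 :=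
      (innerSL ℂ e).hasFDerivAt.comp_hasDerivAt _ h2
    rw [h3.deriv]
    simp [inner_self_eq_norm_sq_to_K, hne]
  -- `-dslope g 0` is the Carathéodory function `ζ ↦ -⟨h(ζ e), e⟩ / ζ`, extended by its limit at `0`.
  have hmul : ∀ ζ : ℂ, (‖ζ‖ ^ 2 : ℝ) * (-dslope g 0 ζ) = -inner ℂ (ζ • e) (h (ζ • e)) := by
    intro ζ
    rcases eq_or_ne ζ 0 with rfl | hζ
    · simp
    · rw [dslope_of_ne _ hζ, slope_def_field, hg0, inner_smul_left, ← Complex.normSq_eq_norm_sq,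
        Complex.normSq_eq_conj_mul_self]
      simp only [hg, sub_zero]
      field_simp
  have hb : ‖(‖z‖ : ℂ)‖ = ‖z‖ := by simp
  obtain ⟨k1, k2⟩ := caratheodory_bounds (p := fun ζ => -dslope g 0 ζ) (ζ := (‖z‖ : ℂ))
    ((Complex.differentiableOn_dslope (Metric.ball_mem_nhds _ one_pos)).2 hgd).neg
    (by simp [hg']) (fun ζ hζ => by
      rcases eq_or_ne ζ 0 with rfl | hζ0
      · simp [hg']
      have h1 := congrArg Complex.re (hmul ζ)
      have h2 := hre _ (hmaps ζ hζ)
      rw [← inner_conj_symm, Complex.conj_re] at h2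
      rw [Complex.re_ofReal_mul, Complex.neg_re (inner ℂ _ _)] at h1
      have h3 : 0 < ‖ζ‖ ^ 2 := by positivity
      by_contra! hlt
      nlinarith) (by rw [hb]; exact mem_unitBall.1 hz)
  have hm := hmul (‖z‖ : ℂ)
  rw [hze, hb] at hm
  rw [hb] at k1 k2
  constructor
  · have := congrArg norm hm
    rw [norm_mul, norm_neg (inner ℂ _ _), Complex.norm_real, Real.norm_eq_abs, abs_of_nonneg
      (by positivity)] at this
    rw [← this]
    gcongr
  · have := congrArg Complex.re hm
    rw [Complex.re_ofReal_mul, Complex.neg_re (inner ℂ _ _)] at this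
    have := mul_le_mul_of_nonneg_left k2 (sq_nonneg ‖z‖)
    linarith

/-- The class is locally uniformly bounded. On the circle `|ζ| = 1` the holomorphic function
`ζ⟨h(z + ζ y), z⟩ + ⟨h(z + ζ y), y⟩` equals `ζ⟨h(z + ζ y), z + ζ y⟩`, which is bounded by the
preceding lemma; by the maximum principle the same bound holds for its value `⟨h(z), y⟩` at
`ζ = 0`. -/
theorem exists_norm_le_of_mem_controlSet (n : ℕ) {r : ℝ} (hr : r < 1) :
    ∃ M, 0 < M ∧ ∀ h ∈ controlSet n, ∀ z ∈ Metric.closedBall (0 : Cn n) r, ‖h z‖ ≤ M := by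
  set ρ : ℝ := (1 - r) / 2 with hρ
  have hρ0 : 0 < ρ := by rw [hρ]; linarith
  set C : ℝ := 2 / (1 - (r + ρ)) with hC
  have hC0 : 0 < C := by rw [hC]; apply div_pos two_pos; rw [hρ]; linarith
  refine ⟨C / ρ, by positivity, fun h hh z hz => ?_⟩
  rw [mem_closedBall_zero_iff] at hz
  rcases eq_or_ne (h z) 0 with h0 | h0
  · rw [h0, norm_zero]; positivity
  have hnz : (‖h z‖ : ℂ) ≠ 0 := by exact_mod_cast norm_ne_zero_iff.2 h0
  -- The direction of `h z` itself turns a bound on `⟨h z, y⟩` into one on `ρ ‖h z‖`.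
  set y : Cn n := ((ρ : ℂ) * (‖h z‖ : ℂ)⁻¹) • h z with hy
  have hyn : ‖y‖ = ρ := by
    rw [hy, norm_smul, norm_mul, norm_inv, Complex.norm_real, Complex.norm_real, norm_norm,
      mul_assoc, inv_mul_cancel₀ (norm_ne_zero_iff.2 h0), mul_one, Real.norm_of_nonneg hρ0.le]
  have hin : ∀ ζ : ℂ, ‖ζ‖ ≤ 1 → ‖z + ζ • y‖ ≤ r + ρ := fun ζ hζ => by
    calc ‖z + ζ • y‖ ≤ ‖z‖ + ‖ζ‖ * ‖y‖ := by rw [← norm_smul]; exact norm_add_le _ _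
      _ ≤ r + 1 * ρ := by rw [hyn]; gcongr
      _ = r + ρ := by ring
  have hrρ : r + ρ < 1 := by rw [hρ]; linarith
  have hdiff : DifferentiableOn ℂ (fun ζ : ℂ => h (z + ζ • y)) (Metric.closedBall 0 1) :=
    hh.1.comp (by fun_prop) fun ζ hζ =>
      mem_unitBall.2 ((hin ζ (by simpa using hζ)).trans_lt hrρ)
  have key := Complex.norm_le_of_forall_mem_frontier_norm_le (U := Metric.ball (0 : ℂ) 1)
    (f := fun ζ : ℂ => ζ * inner ℂ z (h (z + ζ • y)) + inner ℂ y (h (z + ζ • y)))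
    Metric.isBounded_ball (DifferentiableOn.diffContOnCl (by
      rw [closure_ball _ one_ne_zero]
      exact (differentiableOn_id.mul
        ((innerSL ℂ z).differentiable.comp_differentiableOn hdiff)).add
        ((innerSL ℂ y).differentiable.comp_differentiableOn hdiff))) (C := C)
    (fun ζ hζ => by
      rw [frontier_ball _ one_ne_zero, mem_sphere_zero_iff_norm] at hζ
      have hmul : ζ * inner ℂ z (h (z + ζ • y)) + inner ℂ y (h (z + ζ • y)) =
          ζ * inner ℂ (z + ζ • y) (h (z + ζ • y)) := by
        have : ζ * (starRingEnd ℂ) ζ = 1 := by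
          rw [Complex.mul_conj, Complex.normSq_eq_norm_sq, hζ]; norm_num
        rw [inner_add_left, inner_smul_left y _ ζ, mul_add, ← mul_assoc ζ, this, one_mul]
      have hb := hin ζ hζ.le
      rw [hmul, norm_mul, hζ, one_mul]
      refine (inner_bounds_of_mem_controlSet hh (mem_unitBall.2 (hb.trans_lt hrρ))).1.trans ?_
      have h1 : ‖z + ζ • y‖ ^ 2 ≤ 1 := pow_le_one₀ (norm_nonneg _) (hb.trans hrρ.le)
      have h2 : (1 + ‖z + ζ • y‖) / (1 - ‖z + ζ • y‖) ≤ C := by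
        rw [hC]; gcongr; linarith
      calc _ ≤ 1 * C := by
            gcongr
            exact div_nonneg (by positivity) (by linarith)
        _ = C := one_mul C)
    (z := 0) (subset_closure (Metric.mem_ball_self one_pos))
  simp only [zero_mul, zero_smul, add_zero, zero_add] at key
  rw [hy, inner_smul_left, inner_self_eq_norm_sq_to_K, map_mul, map_inv₀, Complex.conj_ofReal,
    Complex.conj_ofReal] at key
  have h1 : (ρ : ℂ) * (‖h z‖ : ℂ)⁻¹ * (‖h z‖ : ℂ) ^ 2 = ((ρ * ‖h z‖ : ℝ) : ℂ) := by
    push_cast; field_simp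
  erw [h1] at key
  rw [Complex.norm_real, Real.norm_of_nonneg (by positivity)] at key
  rw [le_div_iff₀ hρ0]
  linarith

/-- Uniform estimates for the class on a smaller closed ball: a common constant serves as a bound,
as a Lipschitz constant and in the Taylor estimate of order two. -/
theorem exists_uniform_bounds_controlSet (n : ℕ) {r : ℝ} (hr0 : 0 ≤ r) (hr : r < 1) :
    ∃ L, 0 < L ∧ ∀ h ∈ controlSet n, ∀ a ∈ Metric.closedBall (0 : Cn n) r,
      ‖h a‖ ≤ L ∧ ‖fderiv ℂ h a‖ ≤ L ∧ ‖h a + a‖ ≤ L * ‖a‖ ^ 2 ∧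
        ∀ b ∈ Metric.closedBall (0 : Cn n) r, ‖h b - h a‖ ≤ L * ‖b - a‖ ∧
          ‖h b - h a - fderiv ℂ h a (b - a)‖ ≤ L * ‖b - a‖ ^ 2 := by
  set ρ : ℝ := (1 - r) / 2 with hρ
  have hρ0 : 0 < ρ := by rw [hρ]; linarith
  have hρ1 : ρ ≤ 1 := by rw [hρ]; linarith
  have hrρ : r + ρ < 1 := by rw [hρ]; linarith
  obtain ⟨M, hM0, hM⟩ := exists_norm_le_of_mem_controlSet n hrρ
  have hsub : ∀ a ∈ Metric.closedBall (0 : Cn n) r, ∀ w ∈ Metric.ball a ρ,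
      w ∈ Metric.closedBall (0 : Cn n) (r + ρ) := fun a ha w hw => by
    rw [mem_closedBall_zero_iff] at ha ⊢
    rw [mem_ball_iff_norm] at hw
    linarith [norm_le_norm_add_norm_sub' w a]
  have hL1 : 2 * M / ρ ≤ 4 * M / ρ ^ 2 := by
    rw [div_le_div_iff₀ hρ0 (by positivity)]
    nlinarith [mul_pos hM0 hρ0]
  have hL0 : M ≤ 4 * M / ρ ^ 2 := by
    rw [le_div_iff₀ (by positivity)]
    nlinarith [mul_le_mul_of_nonneg_left (pow_le_one₀ hρ0.le hρ1 : ρ ^ 2 ≤ 1) hM0.le]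
  have main : ∀ h ∈ controlSet n, ∀ a ∈ Metric.closedBall (0 : Cn n) r,
      ‖fderiv ℂ h a‖ ≤ 2 * M / ρ ∧
        ∀ b ∈ Metric.closedBall (0 : Cn n) r, ‖h b - h a‖ ≤ 2 * M / ρ * ‖b - a‖ ∧
          ‖h b - h a - fderiv ℂ h a (b - a)‖ ≤ 4 * M / ρ ^ 2 * ‖b - a‖ ^ 2 := by
    intro h hh a ha
    have hd : DifferentiableOn ℂ h (Metric.ball a ρ) := hh.1.mono fun w hw =>
      Metric.closedBall_subset_ball hrρ (hsub a ha w hw)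
    have hb : ∀ w ∈ Metric.ball a ρ, ‖h w‖ ≤ M := fun w hw => hM h hh w (hsub a ha w hw)
    have hmono : ∀ w ∈ Metric.closedBall (0 : Cn n) r, ‖h w‖ ≤ M := fun w hw =>
      hM h hh w (Metric.closedBall_subset_closedBall (by linarith) hw)
    have hD := norm_fderiv_le_of_norm_le_on_ball hρ0 hd hb
    refine ⟨hD, fun b hbr => ?_⟩
    by_cases hba : b ∈ Metric.ball a ρ
    · exact ⟨norm_sub_le_of_norm_le_on_ball hd hb hba, norm_taylor_le_of_norm_le_on_ball hd hb hba⟩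
    -- For distant points the bound `M` on the values already suffices, since `1 ≤ ‖b - a‖ / ρ`.
    · rw [mem_ball_iff_norm, not_lt] at hba
      have hq : 1 ≤ ‖b - a‖ / ρ := (one_le_div hρ0).2 hba
      have h2 : ‖h b - h a‖ ≤ 2 * M := by
        linarith [norm_sub_le (h b) (h a), hmono a ha, hmono b hbr]
      have h3 : ‖h b - h a‖ ≤ 2 * M / ρ * ‖b - a‖ := by
        calc ‖h b - h a‖ ≤ 2 * M * 1 := by linarith
          _ ≤ 2 * M * (‖b - a‖ / ρ) := by gcongr
          _ = _ := by ring
      refine ⟨h3, ?_⟩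
      have h4 : ‖fderiv ℂ h a (b - a)‖ ≤ 2 * M / ρ * ‖b - a‖ :=
        (ContinuousLinearMap.le_opNorm _ _).trans (by gcongr)
      calc ‖h b - h a - fderiv ℂ h a (b - a)‖ ≤ 4 * M * (‖b - a‖ / ρ) * 1 := by
            refine (norm_sub_le _ _).trans ((add_le_add h3 h4).trans_eq ?_); ring
        _ ≤ 4 * M * (‖b - a‖ / ρ) * (‖b - a‖ / ρ) := by gcongr
        _ = _ := by field_simp
  refine ⟨4 * M / ρ ^ 2, by positivity, fun h hh a ha => ?_⟩
  obtain ⟨h1, h2⟩ := main h hh a ha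
  refine ⟨(hM h hh a (Metric.closedBall_subset_closedBall (by linarith) ha)).trans hL0,
    h1.trans hL1, ?_, fun b hb => ⟨(h2 b hb).1.trans (by gcongr), (h2 b hb).2⟩⟩
  have := ((main h hh 0 (Metric.mem_closedBall_self hr0)).2 a ha).2
  rw [hh.2.2.1.fderiv, hh.2.1] at this
  simpa using this

end Control

/-! ### Absolutely continuous curves -/

section AbsolutelyContinuous

/-- An absolutely continuous function whose derivative is nonpositive almost everywhere does not
increase. -/
theorem le_of_ae_hasDerivAt_nonpos {f : ℝ → ℝ} {a b : ℝ} (hab : a ≤ b)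
    (hf : AbsolutelyContinuousOnInterval f a b)
    (hf' : ∀ᵐ t ∂(volume.restrict (Icc a b)), ∃ d ≤ 0, HasDerivAt f d t) : f b ≤ f a := by
  have h := hf.integral_deriv_eq_sub
  rw [intervalIntegral.integral_of_le hab, ← integral_Icc_eq_integral_Ioc] at h
  have h2 : ∫ t in Icc a b, deriv f t ≤ 0 := by
    refine integral_nonpos_of_ae ?_
    filter_upwards [hf'] with t ht
    obtain ⟨d, hd, ht⟩ := ht
    simpa [ht.deriv] using hd
  linarith

theorem _root_.AbsolutelyContinuousOnInterval.comp_of_dist_le {X Y : Type*} [PseudoMetricSpace X]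
    [PseudoMetricSpace Y] {f : ℝ → X} {g : X → Y} {a b K : ℝ}
    (hf : AbsolutelyContinuousOnInterval f a b)
    (hg : ∀ p q, dist (g p) (g q) ≤ K * dist p q) :
    AbsolutelyContinuousOnInterval (fun t => g (f t)) a b := by
  refine squeeze_zero (fun t => Finset.sum_nonneg fun i _ => dist_nonneg) (fun t => ?_)
    (by simpa using Tendsto.const_mul K hf)
  rw [Finset.mul_sum]
  exact Finset.sum_le_sum fun i _ => hg _ _

variable {E : Type*} [NormedAddCommGroup E] [InnerProductSpace ℂ E] [NormedSpace ℝ E]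

/-- The Lyapunov principle behind all estimates on trajectories: if the formal derivative of
`w (‖x‖² + c)` is nonpositive almost everywhere, this quantity does not increase. -/
theorem weighted_norm_sq_le {x : ℝ → E} {w : ℝ → ℝ} {c T : ℝ} (hT : 0 ≤ T)
    (hx : AbsolutelyContinuousOnInterval x 0 T) (hw : ContDiff ℝ 1 w)
    (h : ∀ᵐ t ∂(volume.restrict (Icc 0 T)), ∃ v, HasDerivAt x v t ∧
      deriv w t * (‖x t‖ ^ 2 + c) + w t * (2 * (inner ℂ (x t) v).re) ≤ 0) :
    w T * (‖x T‖ ^ 2 + c) ≤ w 0 * (‖x 0‖ ^ 2 + c) := by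
  have hn : AbsolutelyContinuousOnInterval (fun t => ‖x t‖) 0 T :=
    hx.comp_of_dist_le (K := 1) fun p q => by
      rw [one_mul, dist_eq_norm p]; exact dist_norm_norm_le p q
  have hc : AbsolutelyContinuousOnInterval (fun _ : ℝ => c) 0 T :=
    ContDiffOn.absolutelyContinuousOnInterval contDiffOn_const
  have hf : AbsolutelyContinuousOnInterval (w * ((fun t => ‖x t‖) * (fun t => ‖x t‖) +
      fun _ => c)) 0 T :=
    (ContDiffOn.absolutelyContinuousOnInterval hw.contDiffOn).mul ((hn.mul hn).add hc)
  have heq : (w * ((fun t => ‖x t‖) * (fun t => ‖x t‖) + fun _ => c)) =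
      fun t => w t * (‖x t‖ ^ 2 + c) := by
    funext t; simp [sq]
  rw [heq] at hf
  refine le_of_ae_hasDerivAt_nonpos hT hf ?_
  filter_upwards [h] with t ht
  obtain ⟨v, hv, hle⟩ := ht
  refine ⟨_, hle, ?_⟩
  have h1 : HasDerivAt (fun t => ‖x t‖ ^ 2) (2 * (inner ℂ (x t) v).re) t := by
    have h2 := (Complex.reCLM.hasFDerivAt.comp_hasDerivAt t (hv.inner ℂ hv))
    have h3 : (Complex.reCLM ∘ fun t => inner ℂ (x t) (x t)) = fun t => ‖x t‖ ^ 2 := by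
      funext s
      simpa using inner_self_eq_norm_sq (𝕜 := ℂ) (x s)
    rw [h3] at h2
    convert! h2 using 1
    rw [Complex.reCLM_apply, Complex.add_re, ← inner_conj_symm v, Complex.conj_re]
    ring
  exact ((hw.differentiable one_ne_zero t).hasDerivAt).mul (h1.add_const c)

/-- A Gronwall estimate for absolutely continuous curves. -/
theorem norm_sq_le_of_norm_deriv_le {x : ℝ → E} {L ε T : ℝ} (hT : 0 ≤ T) (hL : 0 ≤ L)
    (hx : AbsolutelyContinuousOnInterval x 0 T)
    (h : ∀ᵐ t ∂(volume.restrict (Icc 0 T)), ∃ v, HasDerivAt x v t ∧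
      ‖v‖ ≤ L * ‖x t‖ + ε) :
    ‖x T‖ ^ 2 ≤ Real.exp ((2 * L + 1) * T) * (‖x 0‖ ^ 2 + ε ^ 2) := by
  have hw : ∀ t, HasDerivAt (fun t => Real.exp (-((2 * L + 1) * t)))
      (Real.exp (-((2 * L + 1) * t)) * -((2 * L + 1) * 1)) t := fun t =>
    ((hasDerivAt_id t).const_mul (2 * L + 1)).neg.exp
  have key := weighted_norm_sq_le (c := ε ^ 2) hT hx
    (w := fun t => Real.exp (-((2 * L + 1) * t))) (by fun_prop) (by
      filter_upwards [h] with t ht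
      obtain ⟨v, hv, hle⟩ := ht
      refine ⟨v, hv, ?_⟩
      rw [(hw t).deriv]
      have h1 : (inner ℂ (x t) v).re ≤ ‖x t‖ * (L * ‖x t‖ + ε) :=
        (Complex.re_le_norm _).trans ((norm_inner_le_norm _ _).trans (by gcongr))
      have h2 : 2 * (inner ℂ (x t) v).re ≤ (2 * L + 1) * (‖x t‖ ^ 2 + ε ^ 2) := by
        nlinarith [sq_nonneg (‖x t‖ - ε), mul_nonneg hL (sq_nonneg ε)]
      have h3 := mul_le_mul_of_nonneg_left h2 (Real.exp_pos (-((2 * L + 1) * t))).le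
      linarith)
  simp only [mul_zero, neg_zero, Real.exp_zero, one_mul] at key
  rw [Real.exp_neg, inv_mul_le_iff₀ (Real.exp_pos _)] at key
  linarith [sq_nonneg ε]

/-- A mean value inequality for absolutely continuous curves with exponentially small derivative. -/
theorem norm_sub_le_of_norm_deriv_le_exp {y : ℝ → E} {C a b : ℝ} (hab : a ≤ b) (hC : 0 ≤ C)
    (hy : AbsolutelyContinuousOnInterval y a b)
    (h : ∀ᵐ t ∂(volume.restrict (Icc a b)), ∃ v, HasDerivAt y v t ∧ ‖v‖ ≤ C * Real.exp (-t)) :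
    ‖y b - y a‖ ≤ C * Real.exp (-a) := by
  set u := y b - y a with hu
  -- The real function `Re⟨y t, u⟩ + ‖u‖ C e^{-t}` is nonincreasing; compare its values at `a` and `b`.
  have h1 : AbsolutelyContinuousOnInterval (fun t => (inner ℂ u (y t)).re) a b :=
    hy.comp_of_dist_le (g := fun z => (inner ℂ u z).re) (K := ‖u‖) fun p q => by
      rw [Real.dist_eq, ← Complex.sub_re, ← inner_sub_right, dist_eq_norm]
      exact (Complex.abs_re_le_norm _).trans (norm_inner_le_norm _ _)
  have h2 : AbsolutelyContinuousOnInterval (fun t : ℝ => ‖u‖ * C * Real.exp (-t)) a b :=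
    ContDiffOn.absolutelyContinuousOnInterval (by fun_prop)
  have h3 := le_of_ae_hasDerivAt_nonpos hab (h1.add h2) (by
    filter_upwards [h] with t ht
    obtain ⟨v, hv, hle⟩ := ht
    have d1 := Complex.reCLM.hasFDerivAt.comp_hasDerivAt t
      ((hasDerivAt_const t u).inner ℂ hv)
    have d2 := (((hasDerivAt_id t).neg.exp).const_mul (‖u‖ * C))
    refine ⟨_, ?_, d1.add d2⟩
    simp only [inner_zero_left, add_zero, Complex.reCLM_apply]
    have : (inner ℂ u v).re ≤ ‖u‖ * (C * Real.exp (-t)) :=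
      (Complex.re_le_norm _).trans ((norm_inner_le_norm _ _).trans (by gcongr))
    simp only [Pi.neg_apply, id]
    linarith)
  simp only [Pi.add_apply] at h3
  have h4 : (inner ℂ u (y b)).re - (inner ℂ u (y a)).re = ‖u‖ ^ 2 := by
    rw [← Complex.sub_re, ← inner_sub_right, ← hu]
    simpa using inner_self_eq_norm_sq (𝕜 := ℂ) u
  rcases (norm_nonneg u).eq_or_lt with h0 | h0
  · rw [← h0]; positivity
  · have h5 : ‖u‖ * ‖u‖ ≤ ‖u‖ * (C * Real.exp (-a)) := by
      have : 0 ≤ ‖u‖ * C * Real.exp (-b) := by positivity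
      nlinarith
    exact le_of_mul_le_mul_left h5 h0

end AbsolutelyContinuous

/-! ### Existence for Carathéodory differential equations -/

section Existence

variable {E : Type*} [NormedAddCommGroup E] [MeasurableSpace E] [BorelSpace E]

/-- The superposition of a Carathéodory field with a continuous curve is measurable: the curve is
the pointwise limit of the step functions `s ↦ x (⌊(k + 1) s⌋ / (k + 1))`. -/
theorem aemeasurable_comp_of_caratheodory {F : ℝ → E → E} {μ : Measure ℝ}
    (hmeas : ∀ z, AEMeasurable (fun s => F s z) μ)
    (hF : ∀ᵐ s ∂μ, Continuous (F s)) {x : ℝ → E} (hx : Continuous x) :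
    AEMeasurable (fun s => F s (x s)) μ := by
  refine aemeasurable_of_tendsto_metrizable_ae (u := atTop)
    (f := fun (k : ℕ) s => F s (x (⌊((k : ℝ) + 1) * s⌋ / ((k : ℝ) + 1)))) (fun k => ?_) ?_
  · have hU : ⋃ j : ℤ, (fun s : ℝ => ⌊((k : ℝ) + 1) * s⌋) ⁻¹' {j} = univ := by
      ext s; simp
    rw [← Measure.restrict_univ (μ := μ), ← hU, aemeasurable_iUnion_iff]
    intro j
    refine ((hmeas (x (j / ((k : ℝ) + 1)))).restrict).congr ?_
    have hm : MeasurableSet ((fun s : ℝ => ⌊((k : ℝ) + 1) * s⌋) ⁻¹' {j}) :=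
      (Int.measurable_floor.comp (measurable_const.mul measurable_id)) (measurableSet_singleton j)
    filter_upwards [ae_restrict_mem hm] with s hs
    rw [mem_preimage, mem_singleton_iff] at hs
    rw [hs]
  · filter_upwards [hF] with s hs
    refine (hs.tendsto _).comp ((hx.tendsto _).comp ?_)
    have h1 : Tendsto (fun k : ℕ => ((k : ℝ) + 1)) atTop atTop :=
      tendsto_atTop_add_const_right _ _ tendsto_natCast_atTop_atTop
    have h2 : Tendsto (fun k : ℕ => s - ((k : ℝ) + 1)⁻¹) atTop (𝓝 s) := by
      simpa using (tendsto_inv_atTop_zero.comp h1).const_sub s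
    refine tendsto_of_tendsto_of_tendsto_of_le_of_le h2 tendsto_const_nhds (fun k => ?_)
      (fun k => ?_)
    · have hk : (0 : ℝ) < (k : ℝ) + 1 := by positivity
      rw [le_div_iff₀ hk, sub_mul, inv_mul_cancel₀ hk.ne']
      linarith [Int.lt_floor_add_one (((k : ℝ) + 1) * s)]
    · have hk : (0 : ℝ) < (k : ℝ) + 1 := by positivity
      simp only
      rw [div_le_iff₀ hk]
      linarith [Int.floor_le (((k : ℝ) + 1) * s)]

variable [NormedSpace ℝ E] [CompleteSpace E] [SecondCountableTopology E]

/-- Global existence for a Carathéodory differential equation whose right-hand side is bounded and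
uniformly Lipschitz. After the substitution `x t = x₀ + e^{K t} y t` with `K = 2 L + 1`, the
integral equation becomes a fixed point problem for a contraction of bounded continuous
functions. -/
theorem exists_caratheodory_solution {F : ℝ → E → E} {L M : ℝ} (hL : 0 ≤ L) (hM : 0 ≤ M)
    (hmeas : ∀ z, AEMeasurable (fun s => F s z) (volume.restrict (Ici 0)))
    (hF : ∀ᵐ s ∂(volume.restrict (Ici (0 : ℝ))), (∀ p q, ‖F s p - F s q‖ ≤ L * ‖p - q‖) ∧
      ∀ p, ‖F s p‖ ≤ M) (x₀ : E) :
    ∃ x : ℝ → E, (∀ s t, ‖x t - x s‖ ≤ M * |t - s|) ∧ x 0 = x₀ ∧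
      ∀ᵐ t ∂(volume.restrict (Ici (0 : ℝ))), HasDerivAt x (F t (x t)) t := by
  set K : ℝ := 2 * L + 1 with hK
  have hK1 : 1 ≤ K := by rw [hK]; linarith
  -- Extending the integrand by zero makes the primitive vanish for negative times, so that the
  -- functions in the fixed point problem stay bounded on all of `ℝ`.
  let f : (ℝ → E) → ℝ → E := fun x => (Ici (0 : ℝ)).indicator fun s => F s (x s)
  have hFc : ∀ᵐ s ∂(volume.restrict (Ici (0 : ℝ))), Continuous (F s) := by
    filter_upwards [hF] with s hs
    exact (LipschitzWith.of_dist_le_mul (K := L.toNNReal) fun p q => by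
      rw [dist_eq_norm, dist_eq_norm, Real.coe_toNNReal _ hL]; exact hs.1 p q).continuous
  have hfm : ∀ x : ℝ → E, Continuous x → AEStronglyMeasurable (f x) volume := fun x hx =>
    ((aemeasurable_indicator_iff measurableSet_Ici).2
      (aemeasurable_comp_of_caratheodory hmeas hFc hx)).aestronglyMeasurable
  have hF' := (ae_restrict_iff' (measurableSet_Ici (a := (0 : ℝ)))).1 hF
  have hfb : ∀ x : ℝ → E, ∀ᵐ s, ‖f x s‖ ≤ M := fun x => by
    filter_upwards [hF'] with s hs
    by_cases h0 : s ∈ Ici (0 : ℝ)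
    · simpa [f, indicator_of_mem h0] using (hs h0).2 (x s)
    · simpa [f, indicator_of_notMem h0] using hM
  have hfl : ∀ x : ℝ → E, Continuous x → LocallyIntegrable (f x) volume := fun x hx =>
    (locallyIntegrable_const M).mono (hfm x hx) (by
      filter_upwards [hfb x] with s hs
      rwa [Real.norm_of_nonneg hM])
  have hfi : ∀ x : ℝ → E, Continuous x → ∀ a b, IntervalIntegrable (f x) volume a b :=
    fun x hx a b => intervalIntegrable_iff.2
      (((hfl x hx).integrableOn_isCompact isCompact_uIcc).mono_set uIoc_subset_uIcc)
  have hneg : ∀ x : ℝ → E, ∀ t ≤ 0, ∫ s in (0 : ℝ)..t, f x s = 0 := fun x t ht => by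
    rw [intervalIntegral.integral_of_ge ht, neg_eq_zero]
    rw [integral_Ioc_eq_integral_Ioo]
    refine setIntegral_eq_zero_of_forall_eq_zero fun s hs => ?_
    exact indicator_of_notMem (by simpa using hs.2) _
  let X : BoundedContinuousFunction ℝ E → ℝ → E := fun y s => x₀ + Real.exp (K * s) • y s
  have hX : ∀ y, Continuous (X y) := fun y => by
    have := y.continuous
    fun_prop
  have hle : ∀ x : ℝ → E, ∀ a b, ‖∫ s in a..b, f x s‖ ≤ M * |b - a| := fun x a b =>
    intervalIntegral.norm_integral_le_of_norm_le_const_ae (by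
      filter_upwards [hfb x] with s hs _ using hs)
  let Φ : BoundedContinuousFunction ℝ E → BoundedContinuousFunction ℝ E := fun y =>
    BoundedContinuousFunction.ofNormedAddCommGroup
      (fun t => Real.exp (-(K * t)) • ∫ s in (0 : ℝ)..t, f (X y) s)
      ((by fun_prop : Continuous fun t : ℝ => Real.exp (-(K * t))).smul
        (intervalIntegral.continuous_primitive (hfi _ (hX y)) 0)) M (fun t => by
          rcases le_total t 0 with ht | ht
          · rw [hneg _ t ht, smul_zero, norm_zero]; exact hM
          · rw [norm_smul, Real.norm_of_nonneg (Real.exp_pos _).le]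
            have h1 := hle (X y) 0 t
            rw [sub_zero, abs_of_nonneg ht] at h1
            have h2 : t ≤ Real.exp (K * t) := by
              nlinarith [Real.add_one_le_exp (K * t)]
            calc Real.exp (-(K * t)) * ‖∫ s in (0 : ℝ)..t, f (X y) s‖
                ≤ Real.exp (-(K * t)) * (M * Real.exp (K * t)) := by
                  gcongr; exact h1.trans (by gcongr)
              _ = M := by rw [Real.exp_neg]; field_simp)
  have hΦ : ContractingWith (1 / 2) Φ := by
    refine ⟨by rw [← NNReal.coe_lt_coe]; norm_num, LipschitzWith.of_dist_le_mul fun y₁ y₂ => ?_⟩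
    refine (BoundedContinuousFunction.dist_le (by positivity)).2 fun t => ?_
    have hd := dist_nonneg (x := y₁) (y := y₂)
    simp only [Φ, BoundedContinuousFunction.coe_ofNormedAddCommGroup]
    rcases le_total t 0 with ht | ht
    · rw [hneg _ t ht, hneg _ t ht, dist_self]; positivity
    rw [dist_eq_norm, ← smul_sub, norm_smul, Real.norm_of_nonneg (Real.exp_pos _).le,
      ← intervalIntegral.integral_sub (hfi _ (hX y₁) _ _) (hfi _ (hX y₂) _ _)]
    have hint : ∫ s in (0 : ℝ)..t, L * dist y₁ y₂ * Real.exp (K * s) =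
        L * dist y₁ y₂ * ((Real.exp (K * t) - 1) / K) := by
      rw [intervalIntegral.integral_const_mul]
      congr 1
      have hK0 : K ≠ 0 := by positivity
      rw [intervalIntegral.integral_comp_mul_left (fun s => Real.exp s) hK0, integral_exp]
      simp [div_eq_inv_mul]
    have h1 : ‖∫ s in (0 : ℝ)..t, (f (X y₁) s - f (X y₂) s)‖ ≤
        ∫ s in (0 : ℝ)..t, L * dist y₁ y₂ * Real.exp (K * s) := by
      refine intervalIntegral.norm_integral_le_of_norm_le ht ?_
        ((by fun_prop : Continuous fun s : ℝ =>
          L * dist y₁ y₂ * Real.exp (K * s)).intervalIntegrable _ _)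
      filter_upwards [hF'] with s hs hst
      have h0 : s ∈ Ici (0 : ℝ) := hst.1.le
      simp only [f, indicator_of_mem h0]
      refine ((hs h0).1 _ _).trans ?_
      have h2 : ‖X y₁ s - X y₂ s‖ ≤ Real.exp (K * s) * dist y₁ y₂ := by
        simp only [X, add_sub_add_left_eq_sub]
        rw [← smul_sub, norm_smul, Real.norm_of_nonneg (Real.exp_pos _).le, ← dist_eq_norm]
        gcongr
        exact BoundedContinuousFunction.dist_coe_le_dist s
      calc L * ‖X y₁ s - X y₂ s‖ ≤ L * (Real.exp (K * s) * dist y₁ y₂) := by gcongr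
        _ = _ := by ring
    rw [hint] at h1
    have hK0 : 0 < K := by linarith
    have h3 : L / K ≤ 1 / 2 := by
      rw [div_le_div_iff₀ hK0 two_pos, hK]; linarith
    calc Real.exp (-(K * t)) * ‖∫ s in (0 : ℝ)..t, (f (X y₁) s - f (X y₂) s)‖
        ≤ Real.exp (-(K * t)) * (L * dist y₁ y₂ * (Real.exp (K * t) / K)) := by
          gcongr
          refine h1.trans ?_
          gcongr
          linarith
      _ = L / K * dist y₁ y₂ := by rw [Real.exp_neg]; field_simp
      _ ≤ 1 / 2 * dist y₁ y₂ := by gcongr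
      _ = _ := by norm_num
  set y := ContractingWith.fixedPoint Φ hΦ with hy
  have hfix : Φ y = y := hΦ.fixedPoint_isFixedPt
  have hsol : ∀ t, X y t = x₀ + ∫ s in (0 : ℝ)..t, f (X y) s := fun t => by
    have h1 : y t = Real.exp (-(K * t)) • ∫ s in (0 : ℝ)..t, f (X y) s := by
      conv_lhs => rw [← hfix]
      rfl
    change x₀ + Real.exp (K * t) • y t = _
    rw [h1, smul_smul, ← Real.exp_add, add_neg_cancel, Real.exp_zero, one_smul]
  refine ⟨X y, fun s t => ?_, by rw [hsol]; simp, ?_⟩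
  · rw [hsol t, hsol s, add_sub_add_left_eq_sub, intervalIntegral.integral_interval_sub_left
      (hfi _ (hX y) _ _) (hfi _ (hX y) _ _)]
    exact hle _ _ _
  · have hder := LocallyIntegrable.ae_hasDerivAt_integral (hfl _ (hX y))
    filter_upwards [ae_restrict_of_ae hder, ae_restrict_mem measurableSet_Ici] with t ht ht0
    have h1 := (ht 0).const_add x₀
    have h2 : f (X y) t = F t (X y t) := indicator_of_mem ht0 _
    rw [h2] at h1
    exact h1.congr_of_eventuallyEq (Eventually.of_forall hsol)

end Existence

/-! ### A criterion for complex differentiability -/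

section QuasiLinear

variable {E F : Type*} [NormedAddCommGroup E] [NormedSpace ℂ E] [FiniteDimensional ℂ E]
  [NormedAddCommGroup F] [NormedSpace ℂ F] [CompleteSpace F]

/-- A map whose increments at `a` are linear up to a quadratic error is complex differentiable at
`a`. The differential is the limit of `(k + 1) (f (a + v / (k + 1)) - f a)`. -/
theorem differentiableAt_of_quasilinear {f : E → F} {a : E} {δ C : ℝ} (hδ : 0 < δ)
    (H : ∀ (c : ℂ) (u v w : E), ‖u‖ < δ → ‖v‖ < δ → ‖w‖ < δ → c • u = v + w →
      ‖c • (f (a + u) - f a) - (f (a + v) - f a) - (f (a + w) - f a)‖ ≤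
        C * (‖c‖ * ‖u‖ ^ 2 + ‖v‖ ^ 2 + ‖w‖ ^ 2)) :
    DifferentiableAt ℂ f a := by
  set g : E → F := fun v => f (a + v) - f a with hg
  have g0 : g 0 = 0 := by simp [hg]
  have H' : ∀ (c : ℂ) (u v w : E), ‖u‖ < δ → ‖v‖ < δ → ‖w‖ < δ → c • u = v + w →
      ‖c • g u - g v - g w‖ ≤ C * (‖c‖ * ‖u‖ ^ 2 + ‖v‖ ^ 2 + ‖w‖ ^ 2) := H
  set s : ℕ → ℂ := fun k => (k : ℂ) + 1 with hs
  have hs0 : ∀ k, s k ≠ 0 := fun k => Nat.cast_add_one_ne_zero k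
  have hsn : ∀ k, ‖s k‖ = (k : ℝ) + 1 := fun k => by
    have : s k = (((k : ℝ) + 1 : ℝ) : ℂ) := by simp [hs]
    rw [this, Complex.norm_real, Real.norm_of_nonneg (by positivity)]
  have hst : Tendsto (fun k => ‖s k‖⁻¹) atTop (𝓝 0) := by
    simp_rw [hsn]
    exact tendsto_inv_atTop_zero.comp
      (tendsto_atTop_add_const_right _ _ tendsto_natCast_atTop_atTop)
  set q : ℕ → E → F := fun k v => s k • g ((s k)⁻¹ • v) with hq
  have hnorm : ∀ k (v : E), ‖(s k)⁻¹ • v‖ = ‖s k‖⁻¹ * ‖v‖ := fun k v => by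
    rw [norm_smul, norm_inv]
  have hsmall : ∀ v : E, ∀ᶠ k in atTop, ‖(s k)⁻¹ • v‖ < δ := fun v => by
    simp_rw [hnorm]
    have : Tendsto (fun k => ‖s k‖⁻¹ * ‖v‖) atTop (𝓝 0) := by simpa using hst.mul_const ‖v‖
    exact this.eventually_lt_const hδ
  have hcmp : ∀ (v : E) (k m : ℕ), ‖(s k)⁻¹ • v‖ < δ → ‖(s m)⁻¹ • v‖ < δ →
      ‖q k v - q m v‖ ≤ C * ‖v‖ ^ 2 * (‖s k‖⁻¹ + ‖s m‖⁻¹) := fun v k m hk hm => by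
    have hk0 := norm_pos_iff.2 (hs0 k)
    have hm0 := norm_pos_iff.2 (hs0 m)
    have h1 := H' (s k / s m) ((s k)⁻¹ • v) ((s m)⁻¹ • v) 0 hk hm (by simpa using hδ) (by
      rw [smul_smul, add_zero]; congr 1; field_simp [hs0 k, hs0 m])
    have h2 : q k v - q m v = s m • ((s k / s m) • g ((s k)⁻¹ • v) - g ((s m)⁻¹ • v) - g 0) := by
      rw [g0, sub_zero, smul_sub, smul_smul, mul_div_cancel₀ _ (hs0 m)]
    rw [h2, norm_smul]
    calc _ ≤ ‖s m‖ * _ := mul_le_mul_of_nonneg_left h1 hm0.le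
      _ = _ := by
        rw [hnorm, hnorm, norm_zero, norm_div]
        field_simp
        ring
  have hlim : ∀ v, ∃ d, Tendsto (fun k => q k v) atTop (𝓝 d) := fun v => by
    refine cauchySeq_tendsto_of_complete ?_
    rw [Metric.cauchySeq_iff]
    intro ε hε
    have h1 : Tendsto (fun k => C * ‖v‖ ^ 2 * ‖s k‖⁻¹) atTop (𝓝 0) := by
      simpa using hst.const_mul (C * ‖v‖ ^ 2)
    obtain ⟨N, hN⟩ := eventually_atTop.1
      ((hsmall v).and (h1.eventually_lt_const (half_pos hε)))
    refine ⟨N, fun k hk m hm => ?_⟩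
    rw [dist_eq_norm]
    have h2 := hcmp v k m (hN k hk).1 (hN m hm).1
    rw [mul_add] at h2
    linarith [(hN k hk).2, (hN m hm).2]
  choose D hD using hlim
  have hcomb : ∀ (c : ℂ) (u v w : E), c • u = v + w → c • D u = D v + D w := by
    intro c u v w huvw
    have hzero : Tendsto (fun k => c • q k u - q k v - q k w) atTop (𝓝 0) := by
      rw [tendsto_zero_iff_norm_tendsto_zero]
      have h1 : Tendsto (fun k => C * (‖c‖ * ‖u‖ ^ 2 + ‖v‖ ^ 2 + ‖w‖ ^ 2) * ‖s k‖⁻¹) atTop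
          (𝓝 0) := by
        simpa using hst.const_mul (C * (‖c‖ * ‖u‖ ^ 2 + ‖v‖ ^ 2 + ‖w‖ ^ 2))
      refine squeeze_zero' (Eventually.of_forall fun _ => norm_nonneg _) ?_ h1
      filter_upwards [hsmall u, hsmall v, hsmall w] with k hu hv hw
      have hk0 := norm_pos_iff.2 (hs0 k)
      have h2 := H' c _ _ _ hu hv hw (by rw [smul_comm, huvw, smul_add])
      have h3 : c • q k u - q k v - q k w =
          s k • (c • g ((s k)⁻¹ • u) - g ((s k)⁻¹ • v) - g ((s k)⁻¹ • w)) := by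
        rw [smul_sub, smul_sub, smul_comm (s k) c]
      rw [h3, norm_smul]
      calc _ ≤ ‖s k‖ * _ := mul_le_mul_of_nonneg_left h2 hk0.le
        _ = _ := by
          rw [hnorm, hnorm, hnorm]
          field_simp
    have h4 := tendsto_nhds_unique hzero ((((hD u).const_smul c).sub (hD v)).sub (hD w))
    rw [eq_comm, sub_sub, sub_eq_zero] at h4
    exact h4
  have hD0 : D 0 = 0 := by
    have := hcomb 0 0 0 0 (by simp)
    have h2 := hcomb 1 0 0 0 (by simp)
    rw [one_smul] at h2
    simpa using h2
  let A : E →ₗ[ℂ] F :=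
    { toFun := D
      map_add' := fun v w => by simpa using hcomb 1 (v + w) v w (by simp)
      map_smul' := fun c v => by simpa [hD0] using (hcomb c v (c • v) 0 (by simp)).symm }
  have hA : ∀ v, ‖v‖ < δ → ‖g v - A v‖ ≤ C * ‖v‖ ^ 2 := fun v hv => by
    have h1 : Tendsto (fun m => C * ‖v‖ ^ 2 * (1 + ‖s m‖⁻¹)) atTop (𝓝 (C * ‖v‖ ^ 2)) := by
      simpa using (hst.const_add 1).const_mul (C * ‖v‖ ^ 2)
    refine le_of_tendsto_of_tendsto ((hD v).const_sub (g v)).norm h1 ?_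
    filter_upwards [hsmall v] with m hm
    have := hcmp v 0 m (by simpa [hs] using hv) hm
    simpa [hq, hs] using this
  refine HasFDerivAt.differentiableAt (f' := LinearMap.toContinuousLinearMap A) ?_
  rw [hasFDerivAt_iff_isLittleO_nhds_zero]
  have hO : (fun v => f (a + v) - f a - LinearMap.toContinuousLinearMap A v) =O[𝓝 0]
      fun v : E => ‖v‖ ^ 2 := by
    refine Asymptotics.IsBigO.of_bound C ?_
    filter_upwards [Metric.ball_mem_nhds (0 : E) hδ] with v hv
    rw [Real.norm_of_nonneg (by positivity)]
    exact hA v (by simpa using hv)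
  refine hO.trans_isLittleO ?_
  simpa using (Asymptotics.isLittleO_norm_pow_id (E' := E) one_lt_two)

/-- A pointwise limit of uniformly bounded holomorphic maps is holomorphic. -/
theorem differentiableAt_of_tendsto_of_norm_le {ι : Type*} {l : Filter ι} [l.NeBot]
    {φ : ι → E → F} {f : E → F} {a : E} {R M : ℝ} (hR : 0 < R)
    (hφ : ∀ᶠ i in l, DifferentiableOn ℂ (φ i) (Metric.ball a R) ∧
      ∀ w ∈ Metric.ball a R, ‖φ i w‖ ≤ M)
    (hlim : ∀ z ∈ Metric.ball a R, Tendsto (fun i => φ i z) l (𝓝 (f z))) :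
    DifferentiableAt ℂ f a := by
  refine differentiableAt_of_quasilinear (C := 4 * M / R ^ 2) hR
    fun c u v w hu hv hw huvw => ?_
  have hmem : ∀ x : E, ‖x‖ < R → a + x ∈ Metric.ball a R := fun x hx => by
    simpa [mem_ball_iff_norm] using hx
  have ha := hlim a (Metric.mem_ball_self hR)
  refine le_of_tendsto (((((hlim _ (hmem u hu)).sub ha).const_smul c).sub
    ((hlim _ (hmem v hv)).sub ha)).sub ((hlim _ (hmem w hw)).sub ha)).norm ?_
  filter_upwards [hφ] with i hi
  have key : ∀ x : E, ‖x‖ < R → ‖φ i (a + x) - φ i a - fderiv ℂ (φ i) a x‖ ≤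
      4 * M / R ^ 2 * ‖x‖ ^ 2 := fun x hx => by
    simpa using norm_taylor_le_of_norm_le_on_ball hi.1 hi.2 (hmem x hx)
  set A := fderiv ℂ (φ i) a
  have h1 : c • (φ i (a + u) - φ i a) - (φ i (a + v) - φ i a) - (φ i (a + w) - φ i a) =
      c • (φ i (a + u) - φ i a - A u) - (φ i (a + v) - φ i a - A v) -
        (φ i (a + w) - φ i a - A w) := by
    have : c • A u = A v + A w := by rw [← map_smul, huvw, map_add]
    rw [smul_sub c _ (A u), this]
    abel
  rw [h1]
  refine (norm_sub_le _ _).trans ((add_le_add ((norm_sub_le _ _).trans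
    (add_le_add ((norm_smul_le _ _).trans (mul_le_mul_of_nonneg_left (key u hu)
      (norm_nonneg c))) (key v hv))) (key w hw)).trans_eq ?_)
  ring

end QuasiLinear

/-! ### Radial retraction -/

section RadialRetraction

variable {n : ℕ}

/-- The radial retraction of `ℂⁿ` onto the closed ball of radius `r`. -/
def radialRetraction (r : ℝ) (z : Cn n) : Cn n := ((r / max r ‖z‖ : ℝ) : ℂ) • z

theorem radialRetraction_of_norm_le {r : ℝ} (hr : 0 < r) {z : Cn n} (hz : ‖z‖ ≤ r) :
    radialRetraction r z = z := by
  rw [radialRetraction, max_eq_left hz, div_self hr.ne', Complex.ofReal_one, one_smul]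

theorem radialRetraction_mem_closedBall {r : ℝ} (hr : 0 < r) (z : Cn n) :
    radialRetraction r z ∈ Metric.closedBall (0 : Cn n) r := by
  have hm : 0 < max r ‖z‖ := lt_max_of_lt_left hr
  rw [mem_closedBall_zero_iff, radialRetraction, norm_smul, Complex.norm_real,
    Real.norm_of_nonneg (by positivity), div_mul_eq_mul_div, div_le_iff₀ hm]
  gcongr
  exact le_max_right _ _

theorem norm_radialRetraction_sub_le {r : ℝ} (hr : 0 < r) (z w : Cn n) :
    ‖radialRetraction r z - radialRetraction r w‖ ≤ 2 * ‖z - w‖ := by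
  have hz : 0 < max r ‖z‖ := lt_max_of_lt_left hr
  have hw : 0 < max r ‖w‖ := lt_max_of_lt_left hr
  have h1 : radialRetraction r z - radialRetraction r w = ((r / max r ‖z‖ : ℝ) : ℂ) • (z - w) +
      ((r / max r ‖z‖ - r / max r ‖w‖ : ℝ) : ℂ) • w := by
    rw [radialRetraction, radialRetraction, smul_sub, Complex.ofReal_sub, sub_smul]
    abel
  have h2 : r / max r ‖z‖ ≤ 1 := (div_le_one hz).2 (le_max_left _ _)
  have h3 : |r / max r ‖z‖ - r / max r ‖w‖| * ‖w‖ ≤ ‖z - w‖ := by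
    have e : r / max r ‖z‖ - r / max r ‖w‖ =
        r / max r ‖z‖ * ((max r ‖w‖ - max r ‖z‖) / max r ‖w‖) := by
      field_simp
    have h4 : |max r ‖w‖ - max r ‖z‖| ≤ ‖z - w‖ := by
      rw [max_comm r, max_comm r, norm_sub_rev]
      exact (abs_max_sub_max_le_abs _ _ _).trans (abs_norm_sub_norm_le w z)
    rw [e, abs_mul, abs_of_nonneg (by positivity : 0 ≤ r / max r ‖z‖), abs_div, abs_of_pos hw]
    calc r / max r ‖z‖ * (|max r ‖w‖ - max r ‖z‖| / max r ‖w‖) * ‖w‖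
        ≤ 1 * (‖z - w‖ / max r ‖w‖) * max r ‖w‖ := by
          gcongr
          exact le_max_right _ _
      _ = ‖z - w‖ := by field_simp
  rw [h1]
  refine (norm_add_le _ _).trans ?_
  rw [norm_smul, norm_smul, Complex.norm_real, Complex.norm_real,
    Real.norm_of_nonneg (by positivity), Real.norm_eq_abs]
  have := mul_le_mul_of_nonneg_right h2 (norm_nonneg (z - w))
  linarith

end RadialRetraction

/-! ### Solutions of the Loewner equation -/

section Flow

variable {n : ℕ} {G : Cn n → ℝ → Cn n} {φ : ℝ → Cn n → Cn n}

theorem re_inner_nonpos_of_mem_controlSet {h : Cn n → Cn n} (hh : h ∈ controlSet n) {z : Cn n}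
    (hz : z ∈ unitBall n) : (inner ℂ z (h z)).re ≤ 0 := by
  have := hh.2.2.2 z hz
  rwa [← inner_conj_symm, Complex.conj_re] at this

/-- Existence of the trajectory through each point: the field is composed with the retraction onto
a closed ball containing the initial point, and solutions never leave that ball because the field
points inwards. -/
theorem exists_isLoewnerSolution (hG : IsHerglotzField n G) : ∃ φ, IsLoewnerSolution n G φ := by
  have main : ∀ z ∈ unitBall n, ∃ x : ℝ → Cn n, x 0 = z ∧ (∀ t, 0 ≤ t → x t ∈ unitBall n) ∧
      (∀ T, 0 ≤ T → AbsolutelyContinuousOnInterval x 0 T) ∧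
      ∀ᵐ t ∂(volume.restrict (Ici (0 : ℝ))), HasDerivAt x (G (x t) t) t := by
    intro z hz
    rw [mem_unitBall] at hz
    set r : ℝ := (1 + ‖z‖) / 2 with hr
    have hz0 := norm_nonneg z
    have hr0 : 0 < r := by rw [hr]; linarith
    have hr1 : r < 1 := by rw [hr]; linarith
    have hzr : ‖z‖ ≤ r := by rw [hr]; linarith
    have hPm : ∀ w : Cn n, radialRetraction r w ∈ unitBall n := fun w =>
      Metric.closedBall_subset_ball hr1 (radialRetraction_mem_closedBall hr0 w)
    obtain ⟨L, hL0, hL⟩ := exists_uniform_bounds_controlSet n hr0.le hr1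
    obtain ⟨x, hxl, hx0, hx⟩ := exists_caratheodory_solution (E := Cn n)
      (F := fun s w => G (radialRetraction r w) s) (L := L * 2) (M := L) (by positivity) hL0.le
      (fun w => hG.measurable _ (hPm w)) (by
        filter_upwards [hG.mem_controlSet] with s hs
        refine ⟨fun p q => ?_, fun p => (hL _ hs _ (radialRetraction_mem_closedBall hr0 p)).1⟩
        refine (((hL _ hs _ (radialRetraction_mem_closedBall hr0 q)).2.2.2 _
          (radialRetraction_mem_closedBall hr0 p)).1).trans ?_
        rw [mul_assoc]
        gcongr
        exact norm_radialRetraction_sub_le hr0 p q) z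
    have hac : ∀ T, AbsolutelyContinuousOnInterval x 0 T := fun T =>
      LipschitzOnWith.absolutelyContinuousOnInterval (K := L.toNNReal)
        (LipschitzOnWith.of_dist_le_mul fun s _ t _ => by
          rw [Real.coe_toNNReal _ hL0.le, dist_eq_norm, Real.dist_eq]; exact hxl t s)
    have hxr : ∀ t, 0 ≤ t → ‖x t‖ ≤ r := by
      intro T hT
      have key := weighted_norm_sq_le (w := fun _ => 1) (c := 0) hT (hac T) contDiff_const (by
        filter_upwards [ae_restrict_of_ae_restrict_of_subset Icc_subset_Ici_self hx,
          ae_restrict_of_ae_restrict_of_subset Icc_subset_Ici_self hG.mem_controlSet] with t ht hc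
        refine ⟨_, ht, ?_⟩
        have h1 := re_inner_nonpos_of_mem_controlSet hc (hPm (x t))
        nth_rewrite 1 [radialRetraction] at h1
        have hm : 0 < r / max r ‖x t‖ := div_pos hr0 (lt_max_of_lt_left hr0)
        rw [inner_smul_left, Complex.conj_ofReal, Complex.re_ofReal_mul] at h1
        have h2 := nonpos_of_mul_nonpos_right h1 hm
        rw [deriv_const]
        linarith)
      rw [hx0] at key
      simp only [add_zero, one_mul] at key
      exact (pow_le_pow_iff_left₀ (norm_nonneg _) (norm_nonneg _) two_ne_zero).1 key |>.trans hzr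
    refine ⟨x, hx0, fun t ht => mem_unitBall.2 ((hxr t ht).trans_lt hr1), fun T _ => hac T, ?_⟩
    filter_upwards [hx, ae_restrict_mem measurableSet_Ici] with t ht ht0
    rwa [radialRetraction_of_norm_le hr0 (hxr t ht0)] at ht
  choose! x hx using main
  exact ⟨fun t z => x z t, fun z hz => (hx z hz).2.1, fun z hz => (hx z hz).2.2.1,
    fun z hz => (hx z hz).2.2.2, fun z hz => (hx z hz).1⟩

theorem IsHerglotzField.ae_mem (hG : IsHerglotzField n G) (T : ℝ) :
    ∀ᵐ t ∂(volume.restrict (Icc 0 T)), (fun z => G z t) ∈ controlSet n :=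
  ae_restrict_of_ae_restrict_of_subset Icc_subset_Ici_self hG.mem_controlSet

namespace IsLoewnerSolution

theorem ae_hasDerivAt (hφ : IsLoewnerSolution n G φ) {z : Cn n} (hz : z ∈ unitBall n) (T : ℝ) :
    ∀ᵐ t ∂(volume.restrict (Icc 0 T)), HasDerivAt (fun s => φ s z) (G (φ t z) t) t :=
  ae_restrict_of_ae_restrict_of_subset Icc_subset_Ici_self (hφ.equation z hz)

theorem norm_le (hφ : IsLoewnerSolution n G φ) (hG : IsHerglotzField n G) {z : Cn n}
    (hz : z ∈ unitBall n) {T : ℝ} (hT : 0 ≤ T) : ‖φ T z‖ ≤ ‖z‖ := by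
  have key := weighted_norm_sq_le (w := fun _ => 1) (c := 0) hT
    (hφ.absolutelyContinuous z hz T hT) contDiff_const (by
      filter_upwards [hφ.ae_hasDerivAt hz T, hG.ae_mem T, ae_restrict_mem measurableSet_Icc]
        with t ht hc htT
      refine ⟨_, ht, ?_⟩
      have h1 := re_inner_nonpos_of_mem_controlSet hc (hφ.mem_ball z hz t htT.1)
      rw [deriv_const]
      linarith)
  rw [hφ.initial z hz] at key
  simp only [add_zero, one_mul] at key
  exact (pow_le_pow_iff_left₀ (norm_nonneg _) (norm_nonneg _) two_ne_zero).1 key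

theorem mem_closedBall (hφ : IsLoewnerSolution n G φ) (hG : IsHerglotzField n G) {r : ℝ}
    (hr : r < 1) {z : Cn n} (hz : ‖z‖ ≤ r) {t : ℝ} (ht : 0 ≤ t) :
    φ t z ∈ Metric.closedBall (0 : Cn n) r :=
  mem_closedBall_zero_iff.2
    ((hφ.norm_le hG (mem_unitBall.2 (hz.trans_lt hr)) ht).trans hz)

/-- Solutions at time `T` depend only on the values of the field on `[0, T]`. -/
theorem eq_of_field_eq {G' : Cn n → ℝ → Cn n} {ψ : ℝ → Cn n → Cn n}
    (hφ : IsLoewnerSolution n G φ) (hG : IsHerglotzField n G) (hψ : IsLoewnerSolution n G' ψ)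
    (hG' : IsHerglotzField n G') {T : ℝ} (hT : 0 ≤ T) (hGG' : ∀ z, ∀ t ≤ T, G z t = G' z t)
    {z : Cn n} (hz : z ∈ unitBall n) : φ T z = ψ T z := by
  obtain ⟨L, hL0, hL⟩ := exists_uniform_bounds_controlSet n (norm_nonneg z) (mem_unitBall.1 hz)
  have key := norm_sq_le_of_norm_deriv_le (ε := 0) hT hL0.le
    ((hφ.absolutelyContinuous z hz T hT).sub (hψ.absolutelyContinuous z hz T hT)) (by
      filter_upwards [hφ.ae_hasDerivAt hz T, hψ.ae_hasDerivAt hz T, hG.ae_mem T,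
        ae_restrict_mem measurableSet_Icc] with t h1 h2 hc htT
      refine ⟨_, h1.sub h2, ?_⟩
      rw [← hGG' _ t htT.2, add_zero]
      exact ((hL _ hc _ (hψ.mem_closedBall hG' (mem_unitBall.1 hz) le_rfl htT.1)).2.2.2 _
        (hφ.mem_closedBall hG (mem_unitBall.1 hz) le_rfl htT.1)).1)
  simp only [Pi.sub_apply, hφ.initial z hz, hψ.initial z hz, sub_self, norm_zero] at key
  norm_num at key
  exact sub_eq_zero.1 key

/-- Lipschitz dependence on the initial point. -/
theorem norm_sub_sq_le (hφ : IsLoewnerSolution n G φ) (hG : IsHerglotzField n G) {r L : ℝ}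
    (hr : r < 1) (hL0 : 0 ≤ L)
    (hL : ∀ h ∈ controlSet n, ∀ a ∈ Metric.closedBall (0 : Cn n) r,
      ∀ b ∈ Metric.closedBall (0 : Cn n) r, ‖h b - h a‖ ≤ L * ‖b - a‖)
    {z w : Cn n} (hz : ‖z‖ ≤ r) (hw : ‖w‖ ≤ r) {T : ℝ} (hT : 0 ≤ T) :
    ‖φ T z - φ T w‖ ^ 2 ≤ Real.exp ((2 * L + 1) * T) * ‖z - w‖ ^ 2 := by
  have hzb : z ∈ unitBall n := mem_unitBall.2 (hz.trans_lt hr)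
  have hwb : w ∈ unitBall n := mem_unitBall.2 (hw.trans_lt hr)
  have key := norm_sq_le_of_norm_deriv_le (ε := 0) hT hL0
    ((hφ.absolutelyContinuous z hzb T hT).sub (hφ.absolutelyContinuous w hwb T hT)) (by
      filter_upwards [hφ.ae_hasDerivAt hzb T, hφ.ae_hasDerivAt hwb T, hG.ae_mem T,
        ae_restrict_mem measurableSet_Icc] with t h1 h2 hc htT
      refine ⟨_, h1.sub h2, ?_⟩
      rw [add_zero]
      exact hL _ hc _ (hφ.mem_closedBall hG hr hw htT.1) _ (hφ.mem_closedBall hG hr hz htT.1))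
  simpa [hφ.initial z hzb, hφ.initial w hwb] using key

/-- The maps `φ_T` are holomorphic. A combination `c (φ_T(b₁) - φ_T(a)) - (φ_T(b₂) - φ_T(a)) -
(φ_T(b₃) - φ_T(a))` with `c (b₁ - a) = (b₂ - a) + (b₃ - a)` starts from `0`, and by Taylor's
formula for the field along `φ_t(a)` it satisfies the linearized equation up to an error that is
quadratic in the increments; the Gronwall estimate then shows that `φ_T` is linear at `a` up to a
quadratic error. -/
theorem mem_Hol (hφ : IsLoewnerSolution n G φ) (hG : IsHerglotzField n G) {T : ℝ} (hT : 0 ≤ T) :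
    φ T ∈ Hol n := by
  intro a ha
  refine DifferentiableAt.differentiableWithinAt ?_
  have ha1 := mem_unitBall.1 ha
  set r : ℝ := (1 + ‖a‖) / 2 with hr
  have hr0 : 0 ≤ r := by rw [hr]; positivity
  have hr1 : r < 1 := by rw [hr]; linarith
  have har : ‖a‖ ≤ r := by rw [hr]; linarith
  obtain ⟨L, hL0, hL⟩ := exists_uniform_bounds_controlSet n hr0 hr1
  set K : ℝ := Real.exp ((2 * L + 1) * T) with hK
  have hK1 : 1 ≤ K := Real.one_le_exp (by positivity)
  refine differentiableAt_of_quasilinear (δ := r - ‖a‖) (C := K * (L * K))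
    (by rw [hr]; linarith) fun c u v w hu hv hw huvw => ?_
  have hmem : ∀ x : Cn n, ‖x‖ < r - ‖a‖ → ‖a + x‖ ≤ r := fun x hx => by
    linarith [norm_add_le a x]
  have hball : ∀ x : Cn n, ‖x‖ < r - ‖a‖ → a + x ∈ unitBall n := fun x hx =>
    mem_unitBall.2 ((hmem x hx).trans_lt hr1)
  have hac : ∀ x : Cn n, ‖x‖ < r - ‖a‖ →
      AbsolutelyContinuousOnInterval (fun t => φ t (a + x) - φ t a) 0 T := fun x hx =>
    (hφ.absolutelyContinuous _ (hball x hx) T hT).sub (hφ.absolutelyContinuous a ha T hT)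
  have hinc : ∀ x : Cn n, ‖x‖ < r - ‖a‖ → ∀ t ∈ Icc 0 T,
      ‖φ t (a + x) - φ t a‖ ^ 2 ≤ K * ‖x‖ ^ 2 := fun x hx t ht => by
    have h1 := hφ.norm_sub_sq_le hG hr1 hL0.le (fun h hh a ha b hb => ((hL h hh a ha).2.2.2 b hb).1)
      (hmem x hx) har ht.1
    rw [add_sub_cancel_left] at h1
    refine h1.trans ?_
    rw [hK]
    gcongr
    exact ht.2
  set Q : ℝ := ‖c‖ * ‖u‖ ^ 2 + ‖v‖ ^ 2 + ‖w‖ ^ 2 with hQ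
  have hQ0 : 0 ≤ Q := by positivity
  have key := norm_sq_le_of_norm_deriv_le (ε := L * K * Q) hT hL0.le
    (x := fun t => c • (φ t (a + u) - φ t a) - (φ t (a + v) - φ t a) - (φ t (a + w) - φ t a))
    ((((hac u hu).const_smul c).sub (hac v hv)).sub (hac w hw)) (by
      filter_upwards [hφ.ae_hasDerivAt ha T, hφ.ae_hasDerivAt (hball u hu) T,
        hφ.ae_hasDerivAt (hball v hv) T, hφ.ae_hasDerivAt (hball w hw) T, hG.ae_mem T,
        ae_restrict_mem measurableSet_Icc] with t da du dv dw hc htT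
      refine ⟨_, (((du.sub da).const_smul c).sub (dv.sub da)).sub (dw.sub da), ?_⟩
      have hat := hφ.mem_closedBall hG hr1 har htT.1
      have tay : ∀ x : Cn n, ‖x‖ < r - ‖a‖ → ‖G (φ t (a + x)) t - G (φ t a) t -
          fderiv ℂ (fun z => G z t) (φ t a) (φ t (a + x) - φ t a)‖ ≤ L * (K * ‖x‖ ^ 2) :=
        fun x hx => by
          refine (((hL _ hc _ hat).2.2.2 _
            (hφ.mem_closedBall hG hr1 (hmem x hx) htT.1)).2).trans ?_
          gcongr
          exact hinc x hx t htT
      have hAL : ‖fderiv ℂ (fun z => G z t) (φ t a)‖ ≤ L := (hL _ hc _ hat).2.1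
      set A := fderiv ℂ (fun z => G z t) (φ t a)
      set e := c • (φ t (a + u) - φ t a) - (φ t (a + v) - φ t a) - (φ t (a + w) - φ t a) with he
      have hsplit : c • (G (φ t (a + u)) t - G (φ t a) t) - (G (φ t (a + v)) t - G (φ t a) t) -
          (G (φ t (a + w)) t - G (φ t a) t) = A e +
          (c • (G (φ t (a + u)) t - G (φ t a) t - A (φ t (a + u) - φ t a)) -
            (G (φ t (a + v)) t - G (φ t a) t - A (φ t (a + v) - φ t a)) -
            (G (φ t (a + w)) t - G (φ t a) t - A (φ t (a + w) - φ t a))) := by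
        rw [he, map_sub A, map_sub A, map_smul A, smul_sub c _ (A _)]
        abel
      rw [hsplit]
      refine (norm_add_le _ _).trans (add_le_add
        ((A.le_opNorm e).trans (mul_le_mul_of_nonneg_right hAL (norm_nonneg _))) ?_)
      refine (norm_sub_le _ _).trans ((add_le_add ((norm_sub_le _ _).trans
        (add_le_add ((norm_smul_le _ _).trans (mul_le_mul_of_nonneg_left (tay u hu)
          (norm_nonneg c))) (tay v hv))) (tay w hw)).trans_eq ?_)
      rw [hQ]
      ring)
  have h0 : c • (φ 0 (a + u) - φ 0 a) - (φ 0 (a + v) - φ 0 a) - (φ 0 (a + w) - φ 0 a) = 0 := by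
    rw [hφ.initial _ ha, hφ.initial _ (hball u hu), hφ.initial _ (hball v hv),
      hφ.initial _ (hball w hw)]
    simp [huvw]
  simp only [h0, norm_zero] at key
  rw [zero_pow two_ne_zero, zero_add, ← hK] at key
  refine (pow_le_pow_iff_left₀ (norm_nonneg _) (by positivity) two_ne_zero).1 (key.trans ?_)
  calc K * (L * K * Q) ^ 2 ≤ K ^ 2 * (L * K * Q) ^ 2 := by
        gcongr
        nlinarith
    _ = (K * (L * K) * Q) ^ 2 := by ring

/-- Exponential decay of the trajectories. The inequality `Re⟨h(z), z⟩ ≤ -κ|z|²` gives the rate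
`κ = (1 - r) / (1 + r)` on the ball of radius `r`; inserting this into
`Re⟨h(z), z⟩ ≤ -|z|² (1 - 2|z|)` improves the rate to `1`. -/
theorem norm_le_exp (hφ : IsLoewnerSolution n G φ) (hG : IsHerglotzField n G) {r : ℝ}
    (hr0 : 0 ≤ r) (hr : r < 1) {z : Cn n} (hz : ‖z‖ ≤ r) {T : ℝ} (hT : 0 ≤ T) :
    ‖φ T z‖ ≤ Real.exp (2 / ((1 - r) / (1 + r))) * Real.exp (-T) := by
  set κ : ℝ := (1 - r) / (1 + r) with hκ
  have hκ0 : 0 < κ := div_pos (by linarith) (by linarith)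
  have hzb : z ∈ unitBall n := mem_unitBall.2 (hz.trans_lt hr)
  have hz1 : ‖z‖ ^ 2 ≤ 1 := pow_le_one₀ (norm_nonneg z) (hz.trans hr.le)
  have hslow : ∀ t, 0 ≤ t → ‖φ t z‖ ≤ Real.exp (-(κ * t)) := by
    intro t ht
    have hw : ∀ s, HasDerivAt (fun s => Real.exp (2 * κ * s))
        (Real.exp (2 * κ * s) * (2 * κ * 1)) s := fun s =>
      ((hasDerivAt_id s).const_mul (2 * κ)).exp
    have key := weighted_norm_sq_le (w := fun s => Real.exp (2 * κ * s)) (c := 0) ht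
      (hφ.absolutelyContinuous z hzb t ht) (by fun_prop) (by
        filter_upwards [hφ.ae_hasDerivAt hzb t, hG.ae_mem t, ae_restrict_mem measurableSet_Icc]
          with s hs hc hst
        refine ⟨_, hs, ?_⟩
        have h1 := (inner_bounds_of_mem_controlSet hc (hφ.mem_ball z hzb s hst.1)).2
        have h2 : ‖φ s z‖ ≤ r := (hφ.norm_le hG hzb hst.1).trans hz
        have h3 : κ ≤ (1 - ‖φ s z‖) / (1 + ‖φ s z‖) := by
          rw [hκ, div_le_div_iff₀ (by linarith) (by positivity)]
          nlinarith
        have h4 := mul_le_mul_of_nonneg_left h3 (sq_nonneg ‖φ s z‖)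
        rw [(hw s).deriv]
        have h5 : 2 * κ * ‖φ s z‖ ^ 2 + 2 * (inner ℂ (φ s z) (G (φ s z) s)).re ≤ 0 := by
          linarith
        have h6 := mul_nonpos_of_nonneg_of_nonpos (Real.exp_pos (2 * κ * s)).le h5
        linarith)
    simp only [add_zero, mul_zero, Real.exp_zero, one_mul] at key
    rw [hφ.initial z hzb] at key
    refine (pow_le_pow_iff_left₀ (norm_nonneg _) (Real.exp_pos _).le two_ne_zero).1 ?_
    rw [← Real.exp_nat_mul, ← mul_le_mul_iff_right₀ (Real.exp_pos (2 * κ * t)), ← Real.exp_add]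
    refine key.trans (hz1.trans (le_of_eq ?_))
    rw [eq_comm, Real.exp_eq_one_iff]
    push_cast
    ring
  have hw : ∀ s, HasDerivAt (fun s => Real.exp (2 * s + 4 / κ * Real.exp (-(κ * s))))
      (Real.exp (2 * s + 4 / κ * Real.exp (-(κ * s))) *
        (2 * 1 + 4 / κ * (Real.exp (-(κ * s)) * -(κ * 1)))) s := fun s =>
    (((hasDerivAt_id s).const_mul 2).add
      ((((hasDerivAt_id s).const_mul κ).neg.exp).const_mul (4 / κ))).exp
  have key := weighted_norm_sq_le (w := fun s => Real.exp (2 * s + 4 / κ * Real.exp (-(κ * s))))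
    (c := 0) hT (hφ.absolutelyContinuous z hzb T hT) (by fun_prop) (by
      filter_upwards [hφ.ae_hasDerivAt hzb T, hG.ae_mem T, ae_restrict_mem measurableSet_Icc]
        with s hs hc hst
      refine ⟨_, hs, ?_⟩
      have h1 := (inner_bounds_of_mem_controlSet hc (hφ.mem_ball z hzb s hst.1)).2
      have h2 := hslow s hst.1
      have h3 : 1 - 2 * ‖φ s z‖ ≤ (1 - ‖φ s z‖) / (1 + ‖φ s z‖) := by
        rw [le_div_iff₀ (by positivity)]
        nlinarith [sq_nonneg ‖φ s z‖]
      have h4 := mul_le_mul_of_nonneg_left h3 (sq_nonneg ‖φ s z‖)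
      have h4' := mul_le_mul_of_nonneg_left h2 (sq_nonneg ‖φ s z‖)
      rw [(hw s).deriv]
      have h5 : (2 * 1 + 4 / κ * (Real.exp (-(κ * s)) * -(κ * 1))) * ‖φ s z‖ ^ 2 +
          2 * (inner ℂ (φ s z) (G (φ s z) s)).re ≤ 0 := by
        have : 4 / κ * (Real.exp (-(κ * s)) * -(κ * 1)) = -(4 * Real.exp (-(κ * s))) := by
          field_simp
        rw [this]
        linarith
      have h6 := mul_nonpos_of_nonneg_of_nonpos
        (Real.exp_pos (2 * s + 4 / κ * Real.exp (-(κ * s)))).le h5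
      linarith)
  simp only [add_zero, mul_zero, neg_zero, zero_add, Real.exp_zero, mul_one] at key
  rw [hφ.initial z hzb] at key
  refine (pow_le_pow_iff_left₀ (norm_nonneg _) (by positivity) two_ne_zero).1 ?_
  rw [← Real.exp_add, ← Real.exp_nat_mul, ← mul_le_mul_iff_right₀ (Real.exp_pos (2 * T)),
    ← Real.exp_add]
  have h7 : Real.exp (2 * T) * ‖φ T z‖ ^ 2 ≤
      Real.exp (2 * T + 4 / κ * Real.exp (-(κ * T))) * ‖φ T z‖ ^ 2 := by
    gcongr
    have : 0 ≤ 4 / κ * Real.exp (-(κ * T)) := by positivity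
    linarith
  refine h7.trans (key.trans ?_)
  calc Real.exp (4 / κ) * ‖z‖ ^ 2 ≤ Real.exp (4 / κ) * 1 := by gcongr
    _ = _ := by
      rw [mul_one]
      congr 1
      push_cast
      ring

theorem hasDerivAt_exp_smul {t : ℝ} {z v : Cn n} (h : HasDerivAt (fun s => φ s z) v t) :
    HasDerivAt (fun s => Real.exp s • φ s z) (Real.exp t • (v + φ t z)) t := by
  rw [smul_add]
  exact (Real.hasDerivAt_exp t).smul h

theorem absolutelyContinuous_exp_smul (hφ : IsLoewnerSolution n G φ) {z : Cn n}
    (hz : z ∈ unitBall n) {a b : ℝ} (ha : 0 ≤ a) (hab : a ≤ b) :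
    AbsolutelyContinuousOnInterval (fun s => Real.exp s • φ s z) a b := by
  refine AbsolutelyContinuousOnInterval.fun_smul (f := Real.exp) (g := fun s => φ s z)
    (ContDiffOn.absolutelyContinuousOnInterval Real.contDiff_exp.contDiffOn)
    ((hφ.absolutelyContinuous z hz b (ha.trans hab)).mono ?_)
  rw [uIcc_of_le hab, uIcc_of_le (ha.trans hab)]
  exact Icc_subset_Icc_left ha

/-- The curves `e^t φ_t` form a Cauchy family, uniformly on every smaller ball, since their
derivative `e^t (G(φ_t, t) + φ_t)` is of order `e^t |φ_t|²`. -/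
theorem exists_norm_exp_smul_sub_le (hφ : IsLoewnerSolution n G φ) (hG : IsHerglotzField n G)
    {r : ℝ} (hr0 : 0 ≤ r) (hr : r < 1) :
    ∃ C, 0 < C ∧ ∀ z : Cn n, ‖z‖ ≤ r → ∀ a b : ℝ, 0 ≤ a → a ≤ b →
      ‖Real.exp b • φ b z - Real.exp a • φ a z‖ ≤ C * Real.exp (-a) := by
  obtain ⟨L, hL0, hL⟩ := exists_uniform_bounds_controlSet n hr0 hr
  set D : ℝ := Real.exp (2 / ((1 - r) / (1 + r))) with hD
  have hD0 : 0 < D := Real.exp_pos _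
  refine ⟨L * D ^ 2, by positivity, fun z hz a b ha hab => ?_⟩
  have hzb : z ∈ unitBall n := mem_unitBall.2 (hz.trans_lt hr)
  refine norm_sub_le_of_norm_deriv_le_exp hab (by positivity)
    (hφ.absolutelyContinuous_exp_smul hzb ha hab) ?_
  have hsub : Icc a b ⊆ Ici (0 : ℝ) := fun t ht => ha.trans ht.1
  filter_upwards [ae_restrict_of_ae_restrict_of_subset hsub (hφ.equation z hzb),
    ae_restrict_of_ae_restrict_of_subset hsub hG.mem_controlSet,
    ae_restrict_mem measurableSet_Icc] with t ht hc htab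
  refine ⟨_, hasDerivAt_exp_smul ht, ?_⟩
  have ht0 : 0 ≤ t := hsub htab
  have h1 := (hL _ hc _ (hφ.mem_closedBall hG hr hz ht0)).2.2.1
  have h2 := hφ.norm_le_exp hG hr0 hr hz ht0
  rw [norm_smul, Real.norm_of_nonneg (Real.exp_pos t).le]
  calc Real.exp t * ‖G (φ t z) t + φ t z‖ ≤ Real.exp t * (L * (D * Real.exp (-t)) ^ 2) := by
        gcongr
        exact h1.trans (by gcongr)
    _ = L * D ^ 2 * Real.exp (-t) := by
        rw [Real.exp_neg]
        field_simp

theorem exp_smul_mem_Hol (hφ : IsLoewnerSolution n G φ) (hG : IsHerglotzField n G) {t : ℝ}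
    (ht : 0 ≤ t) : (fun z => Real.exp t • φ t z) ∈ Hol n :=
  DifferentiableOn.const_smul (hφ.mem_Hol hG ht) (Real.exp t)

/-- Limits are holomorphic: on smaller balls the maps `e^t φ_t` are uniformly bounded, by the
decay estimate. -/
theorem mem_Hol_of_isLoewnerLimit (hφ : IsLoewnerSolution n G φ) (hG : IsHerglotzField n G)
    {f : Cn n → Cn n} (hf : IsLoewnerLimit n φ f) : f ∈ Hol n := by
  intro a ha
  refine DifferentiableAt.differentiableWithinAt ?_
  have ha1 := mem_unitBall.1 ha
  set r : ℝ := (1 + ‖a‖) / 2 with hr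
  have hr0 : 0 ≤ r := by rw [hr]; positivity
  have hr1 : r < 1 := by rw [hr]; linarith
  have hsub : ∀ w ∈ Metric.ball a (r - ‖a‖), ‖w‖ ≤ r := fun w hw => by
    rw [mem_ball_iff_norm] at hw
    linarith [norm_le_norm_add_norm_sub' w a]
  have hsub' : Metric.ball a (r - ‖a‖) ⊆ unitBall n := fun w hw =>
    mem_unitBall.2 ((hsub w hw).trans_lt hr1)
  refine differentiableAt_of_tendsto_of_norm_le (l := atTop)
    (φ := fun (t : ℝ) z => Real.exp t • φ t z) (R := r - ‖a‖)
    (M := Real.exp (2 / ((1 - r) / (1 + r)))) (by rw [hr]; linarith) ?_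
    fun z hz => hf.tendsto_at (hsub' hz)
  filter_upwards [eventually_ge_atTop 0] with t ht
  refine ⟨DifferentiableOn.mono (hφ.exp_smul_mem_Hol hG ht) hsub', fun w hw => ?_⟩
  rw [norm_smul, Real.norm_of_nonneg (Real.exp_pos t).le]
  calc _ ≤ Real.exp t * _ :=
        mul_le_mul_of_nonneg_left (hφ.norm_le_exp hG hr0 hr1 (hsub w hw) ht) (Real.exp_pos t).le
    _ = _ := by
        rw [Real.exp_neg]
        field_simp

theorem exists_isLoewnerLimit (hφ : IsLoewnerSolution n G φ) (hG : IsHerglotzField n G) :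
    ∃ f, IsLoewnerLimit n φ f := by
  have hexp : ∀ C : ℝ, Tendsto (fun t : ℝ => C * Real.exp (-t)) atTop (𝓝 0) := fun C => by
    simpa using (Real.tendsto_exp_neg_atTop_nhds_zero).const_mul C
  have hlim : ∀ z ∈ unitBall n, ∃ y, Tendsto (fun t : ℝ => Real.exp t • φ t z) atTop (𝓝 y) := by
    intro z hz
    obtain ⟨C, hC0, hC⟩ := hφ.exists_norm_exp_smul_sub_le hG (norm_nonneg z) (mem_unitBall.1 hz)
    refine cauchySeq_tendsto_of_complete (Metric.cauchySeq_iff'.2 fun ε hε => ?_)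
    obtain ⟨N, hN, hN0⟩ := (((hexp C).eventually_lt_const hε).and (eventually_ge_atTop 0)).exists
    exact ⟨N, fun t ht => by
      rw [dist_eq_norm]; exact (hC z le_rfl N t hN0 ht).trans_lt hN⟩
  choose! f hf using hlim
  refine ⟨f, Metric.tendstoLocallyUniformlyOn_iff.2 fun ε hε a ha => ?_⟩
  have ha1 := mem_unitBall.1 ha
  set r : ℝ := (1 + ‖a‖) / 2 with hr
  have hr0 : 0 ≤ r := by rw [hr]; positivity
  have hr1 : r < 1 := by rw [hr]; linarith
  obtain ⟨C, hC0, hC⟩ := hφ.exists_norm_exp_smul_sub_le hG hr0 hr1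
  refine ⟨Metric.ball 0 r, mem_nhdsWithin_of_mem_nhds (Metric.isOpen_ball.mem_nhds (by
    rw [mem_ball_zero_iff, hr]; linarith)), ?_⟩
  filter_upwards [(hexp C).eventually_lt_const hε, eventually_ge_atTop 0] with t ht ht0 y hy
  have hyr := mem_ball_zero_iff.1 hy
  rw [dist_eq_norm]
  refine (le_of_tendsto ((hf y (mem_unitBall.2 (hyr.trans hr1))).sub_const _).norm ?_).trans_lt ht
  filter_upwards [eventually_ge_atTop t] with s hs
  exact hC y hyr.le t s ht0 hs

end IsLoewnerSolution

end Flow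

/-! ### Reachable sets and parametric representation -/

section ParametricRepresentation

variable {n : ℕ} {G : Cn n → ℝ → Cn n} {φ : ℝ → Cn n → Cn n}

theorem neg_mem_controlSet (n : ℕ) : (fun z : Cn n => -z) ∈ controlSet n := by
  refine ⟨differentiable_id.neg.differentiableOn, neg_zero, (hasFDerivAt_id _).neg, fun z _ => ?_⟩
  rw [inner_neg_left, Complex.neg_re, neg_nonpos]
  exact inner_self_nonneg (𝕜 := ℂ)

/-- The field that equals `G` up to time `T` and `-id` afterwards. -/
def stoppedField (G : Cn n → ℝ → Cn n) (T : ℝ) (z : Cn n) (t : ℝ) : Cn n :=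
  if t ≤ T then G z t else -z

theorem isHerglotzField_stoppedField (hG : IsHerglotzField n G) (T : ℝ) :
    IsHerglotzField n (stoppedField G T) := by
  refine ⟨fun z hz => ?_, ?_⟩
  · have h1 : stoppedField G T z = fun t =>
        (Iic T).indicator (G z) t + (Ioi T).indicator (fun _ => -z) t := by
      funext t
      rcases le_or_gt t T with h | h
      · simp [stoppedField, h]
      · simp [stoppedField, h, not_le.2 h]
    rw [h1]
    exact ((hG.measurable z hz).indicator measurableSet_Iic).add
      (aemeasurable_const.indicator measurableSet_Ioi)
  · filter_upwards [hG.mem_controlSet] with t ht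
    rcases le_or_gt t T with h | h
    · simpa [stoppedField, h] using ht
    · simpa [stoppedField, not_le.2 h] using neg_mem_controlSet n

/-- Running the field `-id` after time `T` keeps `e^t φ_t` constant, so that `e^T φ_T` is itself
a limit at infinity. -/
theorem IsLoewnerSolution.exp_smul_mem_S0 (hφ : IsLoewnerSolution n G φ)
    (hG : IsHerglotzField n G) {T : ℝ} (hT : 0 ≤ T) :
    (fun z => Real.exp T • φ T z) ∈ S0 n := by
  have hG' := isHerglotzField_stoppedField hG T
  obtain ⟨ψ, hψ⟩ := exists_isLoewnerSolution hG'
  refine ⟨hφ.exp_smul_mem_Hol hG hT, _, ψ, hG', hψ,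
    Metric.tendstoLocallyUniformlyOn_iff.2 fun ε hε a _ =>
      ⟨unitBall n, self_mem_nhdsWithin, ?_⟩⟩
  filter_upwards [eventually_ge_atTop T] with t ht z hz
  have h1 : φ T z = ψ T z := hφ.eq_of_field_eq hG hψ hG' hT
    (fun z s hs => by simp [stoppedField, hs]) hz
  have h2 := norm_sub_le_of_norm_deriv_le_exp (C := 0) ht le_rfl
    (hψ.absolutelyContinuous_exp_smul hz hT ht) (by
      have hsub : Ioc T t ⊆ Ici (0 : ℝ) := fun s hs => hT.trans hs.1.le
      rw [← restrict_Ioc_eq_restrict_Icc]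
      filter_upwards [ae_restrict_of_ae_restrict_of_subset hsub (hψ.equation z hz),
        ae_restrict_mem measurableSet_Ioc] with s hs hsT
      refine ⟨_, IsLoewnerSolution.hasDerivAt_exp_smul hs, ?_⟩
      simp [stoppedField, not_le.2 hsT.1])
  rw [zero_mul, norm_le_zero_iff] at h2
  rw [h1, dist_comm, dist_eq_norm, h2, norm_zero]
  exact hε

theorem S0_subset_reachableSetInfty (n : ℕ) : S0 n ⊆ reachableSetInfty n := by
  rintro f ⟨_, G, φ, hG, hφ, hf⟩
  exact ⟨controlOf G, ⟨G, hG, rfl⟩, φ, ⟨G, rfl, hφ⟩, hf⟩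

theorem isLoewnerSolution_of_isTrajectory {x : ℝ → Cn n → Cn n}
    (hx : IsTrajectory n (controlOf G) x) : IsLoewnerSolution n G x := by
  obtain ⟨G', hG', hx⟩ := hx
  have : G = G' := funext fun z => funext fun t => congrFun (congrFun hG' t) z
  rwa [this]

theorem reachableSetInfty_subset_S0 (n : ℕ) : reachableSetInfty n ⊆ S0 n := by
  rintro f ⟨_, ⟨G, hG, rfl⟩, φ, hφ, hf⟩
  have hφ := isLoewnerSolution_of_isTrajectory hφ
  exact ⟨hφ.mem_Hol_of_isLoewnerLimit hG hf, G, φ, hG, hφ, hf⟩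

theorem reachableSetAt_subset_S0 (n : ℕ) {t : ℝ} (ht : 0 ≤ t) : reachableSetAt n t ⊆ S0 n := by
  rintro f ⟨_, ⟨G, hG, rfl⟩, φ, hφ, hf⟩
  have hφ := isLoewnerSolution_of_isTrajectory hφ
  obtain ⟨h1, G', ψ, hG', hψ, hlim⟩ := hφ.exp_smul_mem_S0 hG ht
  exact ⟨DifferentiableOn.congr h1 fun z hz => hf hz, G', ψ, hG', hψ,
    TendstoLocallyUniformlyOn.congr_right hlim fun z hz => (hf hz).symm⟩

theorem reachableSetInfty_eq_S0 (n : ℕ) : reachableSetInfty n = S0 n :=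
  (reachableSetInfty_subset_S0 n).antisymm (S0_subset_reachableSetInfty n)

theorem overallReachableSet_eq_S0 (n : ℕ) : overallReachableSet n = S0 n := by
  refine Subset.antisymm (union_subset ?_ (reachableSetInfty_subset_S0 n)) ?_
  · exact iUnion₂_subset fun t ht => reachableSetAt_subset_S0 n ht
  · exact (S0_subset_reachableSetInfty n).trans subset_union_right

end ParametricRepresentation

end Loewner

end

/-- The two equalities of sets, followed by the facts that make `x_u(t)` and `lim e^t x_u(t)`
meaningful for every admissible control `u` (existence and uniqueness of the trajectory, existence
of the limit), together with the membership of `e^t x_u(t)` in the class for all `t ≥ 0`. -/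
theorem theorem3p1 (n : ℕ) :
    Loewner.S0 n = Loewner.overallReachableSet n ∧
    Loewner.overallReachableSet n = Loewner.reachableSetInfty n ∧
    ∀ u ∈ Loewner.admissibleControls n, ∃ x, Loewner.IsTrajectory n u x ∧
      (∀ y, Loewner.IsTrajectory n u y →
        ∀ t : ℝ, 0 ≤ t → Set.EqOn (y t) (x t) (Loewner.unitBall n)) ∧
      (∀ t : ℝ, 0 ≤ t → (fun z => Real.exp t • x t z) ∈ Loewner.S0 n) ∧
      ∃ f ∈ Loewner.S0 n, Loewner.IsLoewnerLimit n x f := by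
  refine ⟨(Loewner.overallReachableSet_eq_S0 n).symm,
    (Loewner.overallReachableSet_eq_S0 n).trans (Loewner.reachableSetInfty_eq_S0 n).symm, ?_⟩
  rintro _ ⟨G, hG, rfl⟩
  obtain ⟨φ, hφ⟩ := Loewner.exists_isLoewnerSolution hG
  obtain ⟨f, hf⟩ := hφ.exists_isLoewnerLimit hG
  exact ⟨φ, ⟨G, rfl, hφ⟩,
    fun y hy t ht z hz => (Loewner.isLoewnerSolution_of_isTrajectory hy).eq_of_field_eq hG hφ hG ht
      (fun _ _ _ => rfl) hz,
    fun t ht => hφ.exp_smul_mem_S0 hG ht,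
    f, ⟨hφ.mem_Hol_of_isLoewnerLimit hG hf, G, φ, hG, hφ, hf⟩, hf⟩
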